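/- **Model.** Consider a directed network with nodes $0,\dots,N-1$ in which every node $j\neq 0$ has exactly one incoming link; node $0$ is the gateway. Packet $l=1,2,\dots$ (finitely or infinitely many) is generated at time $s_l$ and arrives at node $0$ at time $a_{l0}$, where $0\le s_1\le s_2\le\cdots$ and $s_l\le a_{l0}$, and only finitely many packets arrive in bounded time; apart from this the sequences $(s_l)$ and $(a_{l0})$ are arbitrary and fixed. A packet that arrives at a node is immediately available to all outgoing links of the node. Each link transmits at most one packet at a time, all links can be active simultaneously, and link $(i,j)$ has a queue of buffer size $B_{ij}\in\{0,1,2,\dots\}\cup\{\infty\}$ for waiting packets (the packet being transmitted is not counted). The system is empty before time $0$. The packet transmission times are non-negative, independent across links and i.i.d. across time on each link. A packet whose transmission was preempted may be sent again; its transmission then either is resumed, or is repeated with the same transmission time, or is repeated with a new independent transmission time (the result holds under each of these three conventions). Let $\Pi$ be the set of all causal policies: at each link a policy decides which packet is transmitted (preemption and idling are allowed) and which packets are kept in the queue, within the buffer size, as a function of the history and the current state of the system (and possibly of an independent random seed), without knowledge of the transmission times of transmissions that have not ended. The non-preemptive Last-Generated, First-Served policy (non-prmp-LGFS) never interrupts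 a transmission; a link that is idle sends the freshest (last generated) packet available to it as soon as there is one; when the queue is full, an arriving packet replaces the oldest packet in the queue if it is fresher than that packet, and is dropped otherwise. For a policy $\pi$, let $\Delta_{j,\pi}(t)=t-\max\big(\{0\}\cup\{s_l: \text{packet } l \text{ has arrived at node } j \text{ by time } t\}\big)$ be the age at node $j$, and $\bar\Delta_{j,\pi}=\limsup_{T\to\infty}\frac1T\,\mathbb E\big[\int_0^T\Delta_{j,\pi}(t)\,dt\big]\in[0,\infty]$ the average age at node $j$. **Theorem.** Suppose moreover that the transmission times are new-better-than-used (NBU), that is, $\mathbb P[X>\tau+t]\le \mathbb P[X>\tau]\,\mathbb P[X>t]$ for all $t,\tau\ge 0$, where $X$ is the transmission time over any given link, and that $B_{ij}\ge 1$ for every link $(i,j)$. Let $k\ge1$, let $j$ be a node that is separated by $k$ links from node $0$, let $0,i_{j,1},\dots,i_{j,k}=j$ be the nodes on the path from node $0$ to $j$, and let $X_{i}$ denote the transmission time over the incoming link to node $i$. Then $$\inf_{\pi\in\Pi}\bar\Delta_{j,\pi}\;\le\;\bar\Delta_{j,\text{non-prmp-LGFS}}\;\le\;\inf_{\pi\in\Pi}\bar\Delta_{j,\pi}+\mathbb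 E[X_{i_{j,1}}]+2\sum_{m=2}^{k}\mathbb E[X_{i_{j,m}}].$$ -/

import Mathlib

open MeasureTheory ProbabilityTheory Filter
open scoped NNReal ENNReal

namespace AgeNet

/-- The data of a multihop network and of its single flow of update packets.
The nodes are `0, …, N - 1` and node `0` is the gateway; `links` is the set of directed links
`(i, j)`.  Packet `l` is generated at time `gen l`, and arrives at node `0` at time `arr l`
(`arr l = ∞` for a packet that does not exist: finitely many packets are allowed).  Both sequences
are arbitrary, except that only finitely many packets arrive in bounded time. -/
structure Network (N : ℕ) where
  links : Finset (Fin N × Fin N)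
  buffer : links → ℕ∞
  gen : ℕ → ℝ≥0
  arr : ℕ → ℝ≥0∞
  gen_mono : Monotone gen
  gen_le_arr : ∀ l, (gen l : ℝ≥0∞) ≤ arr l
  finite_arr : ∀ T : ℝ≥0, {l | arr l ≤ (T : ℝ≥0∞)}.Finite

/-- The links of the network, as a type. -/
abbrev Network.Link {N : ℕ} (I : Network N) : Type := {e : Fin N × Fin N // e ∈ I.links}

/-- Origin of a link. -/
def Network.src {N : ℕ} (I : Network N) (e : I.Link) : Fin N := e.1.1

/-- Destination of a link. -/
def Network.dst {N : ℕ} (I : Network N) (e : I.Link) : Fin N := e.1.2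

/-- Every node other than the gateway has exactly one incoming link. -/
def Network.SingleIn {N : ℕ} [NeZero N] (I : Network N) : Prop :=
  ∀ j : Fin N, j ≠ 0 → ∃! e : I.Link, I.dst e = j

/-- `e 1, …, e k` are the consecutive links of the path from node `0` to node `j`, a path that does
not come back to node `0`.  If every node other than `0` has exactly one incoming link, such a path
is unique when it exists; then `k` is the number of links that separate `j` from node `0`, and
`e m` is the incoming link of the `m`-th node on the path. -/
structure Network.IsPath {N : ℕ} [NeZero N] (I : Network N) (e : ℕ → I.Link) (k : ℕ) (j : Fin N) :
    Prop where
  pos : 1 ≤ k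
  first : I.src (e 1) = 0
  consec : ∀ m, 1 ≤ m → m < k → I.src (e (m + 1)) = I.dst (e m)
  ne_gateway : ∀ m, 1 ≤ m → m ≤ k → I.dst (e m) ≠ 0
  last : I.dst (e k) = j

/-- The packets that have arrived at the gateway by time `T`. -/
noncomputable def Network.arrivedBy {N : ℕ} (I : Network N) (T : ℝ≥0) : Finset ℕ :=
  (I.finite_arr T).toFinset

/-- What becomes of the work spent on a preempted packet when the packet is sent again over the
same link: the transmission goes on where it stopped, or it is repeated with the same transmission
time, or it is repeated with a new, independent transmission time. -/
inductive Preemption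
  | resume
  | restart
  | redraw

/-- What a policy sees of the links at a decision epoch: the packet being transmitted on each link
(`none` for an idle link), and the packets waiting at each link, including those that have just
arrived. -/
structure Snapshot (L : Type) where
  server : L → Option ℕ
  waiting : L → Finset ℕ

/-- All packets present at a link: waiting or being transmitted. -/
def Snapshot.pool {L : Type} (o : Snapshot L) (e : L) : Finset ℕ :=
  o.waiting e ∪ (o.server e).toFinset

/-- A decision: the packet to be transmitted from now on over each link (if any), the packets that
are kept in the queue of each link (all others are discarded), and the time after which the policy
takes its next decision in case that no packet arrives and no transmission ends before
(`∞` if it just waits for the next such event). -/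
structure Action (L : Type) where
  server : L → Option ℕ
  queue : L → Finset ℕ
  wait : ℝ≥0∞

/-- The observed history, the most recent epoch first: the time of each decision epoch, with the
packets that arrived at the gateway and the links that completed a transmission at this time. -/
abbrev History (L : Type) : Type := List (ℝ≥0 × Finset ℕ × Finset L)

/-- A causal policy.  Decisions depend on the history and on the current state of the system (and
possibly on an external random seed in `Ξ`), never on the transmission times of the transmissions
that have not yet ended.  A link can transmit only a packet that is present at the link, and its
queue, which does not hold the packet being transmitted, respects the buffer size.  Preemption,
idling, and dropping or replacing packets are all allowed. -/
structure Policy {N : ℕ} (I : Network N) (Ξ : Type*) [MeasurableSpace Ξ] where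
  decide : Ξ → History I.Link → Snapshot I.Link → Action I.Link
  server_mem : ∀ u h o e p, (decide u h o).server e = some p → p ∈ o.pool e
  queue_subset : ∀ u h o e, (decide u h o).queue e ⊆ o.pool e
  server_notMem : ∀ u h o e p, (decide u h o).server e = some p → p ∉ (decide u h o).queue e
  card_le : ∀ u h o e, (((decide u h o).queue e).card : ℕ∞) ≤ I.buffer e
  measurable_server : ∀ (n : ℕ) (d : Fin n → Finset ℕ × Finset I.Link) (o : Snapshot I.Link)
    (e : I.Link) (p : Option ℕ), MeasurableSet {z : Ξ × (Fin n → ℝ≥0) |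
      (decide z.1 (List.ofFn fun i => (z.2 i, d i)) o).server e = p}
  measurable_queue : ∀ (n : ℕ) (d : Fin n → Finset ℕ × Finset I.Link) (o : Snapshot I.Link)
    (e : I.Link) (S : Finset ℕ), MeasurableSet {z : Ξ × (Fin n → ℝ≥0) |
      (decide z.1 (List.ofFn fun i => (z.2 i, d i)) o).queue e = S}
  measurable_wait : ∀ (n : ℕ) (d : Fin n → Finset ℕ × Finset I.Link) (o : Snapshot I.Link),
    Measurable fun z : Ξ × (Fin n → ℝ≥0) =>
      (decide z.1 (List.ofFn fun i => (z.2 i, d i)) o).wait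

/-- The state of the system just after a decision epoch. -/
structure State {N : ℕ} (I : Network N) where
  /-- time of the epoch -/
  time : ℝ≥0
  /-- packets that have arrived at each node -/
  seen : Fin N → Finset ℕ
  /-- packets in the queue of each link -/
  queue : I.Link → Finset ℕ
  /-- packet in transmission over each link -/
  server : I.Link → Option ℕ
  /-- start of the current transmission over each link -/
  since : I.Link → ℝ≥0
  /-- time spent by each link on the earlier, preempted transmissions of each packet -/
  served : I.Link → ℕ → ℝ≥0
  /-- number of the earlier, preempted transmissions of each packet over each link -/
  tries : I.Link → ℕ → ℕ
  /-- time of the next decision of the policy if nothing happens before -/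
  alarm : ℝ≥0∞
  history : History I.Link

/-- The system is empty at the beginning. -/
def State.empty {N : ℕ} (I : Network N) : State I where
  time := 0
  seen := fun _ => ∅
  queue := fun _ => ∅
  server := fun _ => none
  since := fun _ => 0
  served := fun _ _ => 0
  tries := fun _ _ => 0
  alarm := ⊤
  history := []

section Dynamics

variable {N : ℕ} {I : Network N}

/-- Time at which the current transmission over link `e` ends unless it is preempted; `x e l n` is
the transmission time drawn for packet `l` over link `e` at its `n`-th attempt. -/
noncomputable def State.completion (σ : State I) (mode : Preemption)
    (x : I.Link → ℕ → ℕ → ℝ≥0) (e : I.Link) : ℝ≥0∞ :=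
  match σ.server e with
  | none => ⊤
  | some p =>
    match mode with
    | .resume => ((σ.since e + (x e p 0 - σ.served e p) : ℝ≥0) : ℝ≥0∞)
    | .restart => ((σ.since e + x e p 0 : ℝ≥0) : ℝ≥0∞)
    | .redraw => ((σ.since e + x e p (σ.tries e p) : ℝ≥0) : ℝ≥0∞)

/-- Time of the next epoch: the next arrival at the gateway, the next end of a transmission, or the
next decision that the policy has scheduled, whichever is first. -/
noncomputable def State.nextTime [NeZero N] (σ : State I) (mode : Preemption)
    (x : I.Link → ℕ → ℕ → ℝ≥0) : ℝ≥0∞ :=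
  min (⨅ l ∈ {l : ℕ | l ∉ σ.seen 0}, I.arr l) (min (⨅ e, σ.completion mode x e) σ.alarm)

/-- Links whose transmission has ended by time `T`. -/
noncomputable def State.done (σ : State I) (mode : Preemption)
    (x : I.Link → ℕ → ℕ → ℝ≥0) (T : ℝ≥0) : Finset I.Link :=
  Finset.univ.filter fun e => σ.completion mode x e ≤ (T : ℝ≥0∞)

/-- Packets arriving at the gateway from outside by time `T`, and not before. -/
noncomputable def State.fresh [NeZero N] (σ : State I) (T : ℝ≥0) : Finset ℕ :=
  I.arrivedBy T \ σ.seen 0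

/-- Packets that have arrived at node `j`, after the external arrivals `A` at the gateway and the
ends of the transmissions over the links in `D`. -/
def State.seenAfter [NeZero N] (σ : State I) (A : Finset ℕ) (D : Finset I.Link) (j : Fin N) :
    Finset ℕ :=
  σ.seen j ∪ (if j = 0 then A else ∅) ∪
    (D.filter fun e => I.dst e = j).biUnion fun e => (σ.server e).toFinset

/-- What the policy sees after the external arrivals `A` and the ends of the transmissions over the
links in `D`.  A packet is available to all outgoing links of a node as soon as it arrives at the
node (for the first time). -/
def State.snapshot [NeZero N] (σ : State I) (A : Finset ℕ) (D : Finset I.Link) :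
    Snapshot I.Link where
  server := fun e => if e ∈ D then none else σ.server e
  waiting := fun e => σ.queue e ∪ (σ.seenAfter A D (I.src e) \ σ.seen (I.src e))

/-- The current transmission over link `e` (in the snapshot `o`) is preempted by the action `b`. -/
def preempts (o : Snapshot I.Link) (b : Action I.Link) (e : I.Link) (p : ℕ) : Prop :=
  o.server e = some p ∧ b.server e ≠ some p

open Classical in
/-- The state after an epoch at time `T`, at which all simultaneous events are taken into account
before the policy decides. -/
noncomputable def State.advance [NeZero N] {Ξ : Type*} [MeasurableSpace Ξ] (σ : State I)
    (π : Policy I Ξ) (u : Ξ) (mode : Preemption) (x : I.Link → ℕ → ℕ → ℝ≥0) (T : ℝ≥0) : State I :=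
  let A := σ.fresh T
  let D := σ.done mode x T
  let o := σ.snapshot A D
  let h : History I.Link := (T, A, D) :: σ.history
  let b := π.decide u h o
  { time := T
    seen := σ.seenAfter A D
    queue := b.queue
    server := b.server
    since := fun e => if o.server e = b.server e then σ.since e else T
    served := fun e p => if preempts o b e p then σ.served e p + (T - σ.since e) else σ.served e p
    tries := fun e p => if preempts o b e p then σ.tries e p + 1 else σ.tries e p
    alarm := T + b.wait
    history := h }

open Classical in
/-- One epoch; nothing changes any more when no epoch remains. -/
noncomputable def State.step [NeZero N] {Ξ : Type*} [MeasurableSpace Ξ] (π : Policy I Ξ) (u : Ξ)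
    (mode : Preemption) (x : I.Link → ℕ → ℕ → ℝ≥0) (σ : State I) : State I :=
  if σ.nextTime mode x = ⊤ then σ else σ.advance π u mode x (σ.nextTime mode x).toNNReal

/-- The state after `n` epochs under the policy `π`. -/
noncomputable def run [NeZero N] {Ξ : Type*} [MeasurableSpace Ξ] (π : Policy I Ξ) (u : Ξ)
    (mode : Preemption) (x : I.Link → ℕ → ℕ → ℝ≥0) (n : ℕ) : State I :=
  (State.step π u mode x)^[n] (State.empty I)

/-- Packet `l` has arrived at node `j` by time `t`. -/
def Reached [NeZero N] {Ξ : Type*} [MeasurableSpace Ξ] (π : Policy I Ξ) (u : Ξ)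
    (mode : Preemption) (x : I.Link → ℕ → ℕ → ℝ≥0) (j : Fin N) (t : ℝ≥0) (l : ℕ) : Prop :=
  ∃ n, (run π u mode x n).time ≤ t ∧ l ∈ (run π u mode x n).seen j

/-- Generation time of the freshest packet that has arrived at node `j` by time `t`; it is `0` as
long as there is none. -/
noncomputable def freshest [NeZero N] {Ξ : Type*} [MeasurableSpace Ξ] (π : Policy I Ξ) (u : Ξ)
    (mode : Preemption) (x : I.Link → ℕ → ℕ → ℝ≥0) (j : Fin N) (t : ℝ≥0) : ℝ≥0 :=
  sSup (I.gen '' {l | Reached π u mode x j t l})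

/-- The age at node `j` at time `t` (the freshest generation time never exceeds `t`). -/
noncomputable def age [NeZero N] {Ξ : Type*} [MeasurableSpace Ξ] (π : Policy I Ξ) (u : Ξ)
    (mode : Preemption) (x : I.Link → ℕ → ℕ → ℝ≥0) (j : Fin N) (t : ℝ≥0) : ℝ≥0 :=
  t - freshest π u mode x j t

/-- The average age at node `j`: the upper limit, as `T → ∞`, of the expectation of the integral of
the age over `[0, T]`, divided by `T`. -/
noncomputable def avgAge [NeZero N] {Ω Ξ : Type*} [MeasurableSpace Ω] [MeasurableSpace Ξ]
    (μ : Measure Ω) (ξ : Ω → Ξ) (mode : Preemption) (X : I.Link → ℕ → ℕ → Ω → ℝ≥0)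
    (π : Policy I Ξ) (j : Fin N) : ℝ≥0∞ :=
  limsup (fun T : ℝ =>
    (∫⁻ ω, (∫⁻ t in Set.Icc (0 : ℝ) T,
      (age π (ξ ω) mode (fun e l n => X e l n ω) j t.toNNReal : ℝ≥0∞)) ∂μ) / ENNReal.ofReal T) atTop

end Dynamics

/-- New-better-than-used: `P(Y > τ + t) ≤ P(Y > τ) P(Y > t)` for all `t, τ ≥ 0`. -/
def IsNBU {Ω : Type*} [MeasurableSpace Ω] (μ : Measure Ω) (Y : Ω → ℝ≥0) : Prop :=
  ∀ t τ : ℝ≥0, μ {ω | τ + t < Y ω} ≤ μ {ω | τ < Y ω} * μ {ω | t < Y ω}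

/-- The `B` freshest packets of `S` (all of `S` if it has at most `B` elements).  Generation times
increase with the index of the packet, so that fresher packets have larger indices. -/
noncomputable def keepFreshest (B : ℕ∞) (S : Finset ℕ) : Finset ℕ :=
  open Classical in S.filter fun p => (((S.filter fun q => p < q).card : ℕ) : ℕ∞) < B

theorem keepFreshest_subset (B : ℕ∞) (S : Finset ℕ) : keepFreshest B S ⊆ S := by
  classical
  exact Finset.filter_subset _ _

theorem card_keepFreshest_le (B : ℕ∞) (S : Finset ℕ) : ((keepFreshest B S).card : ℕ∞) ≤ B := by
  classical
  cases B with
  | top => exact le_top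
  | coe n =>
    have h : (keepFreshest (n : ℕ∞) S).card ≤ (Finset.range n).card := by
      apply Finset.card_le_card_of_injOn (fun p => (S.filter fun q => p < q).card)
      · intro p hp
        have hp' : p ∈ keepFreshest (n : ℕ∞) S := hp
        simp only [keepFreshest, Finset.mem_filter] at hp'
        have := hp'.2
        simpa using (by exact_mod_cast this : (S.filter fun q => p < q).card < n)
      · have key : ∀ p q, q ∈ S → p < q →
            (S.filter fun r => q < r).card < (S.filter fun r => p < r).card := by
          intro p q hq hpq
          apply Finset.card_lt_card
          refine (Finset.ssubset_iff_of_subset ?_).2 ⟨q, ?_, ?_⟩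
          · intro r hr
            simp only [Finset.mem_filter] at hr ⊢
            exact ⟨hr.1, hpq.trans hr.2⟩
          · simp [hq, hpq]
          · simp
        intro p hp q hq hpq
        have hpS := keepFreshest_subset _ _ hp
        have hqS := keepFreshest_subset _ _ hq
        have hpq' : (S.filter fun r => p < r).card = (S.filter fun r => q < r).card := hpq
        rcases lt_trichotomy p q with h | h | h
        · have := key p q hqS h
          omega
        · exact h
        · have := key q p hpS h
          omega
    rw [Finset.card_range] at h
    exact_mod_cast h

/-- The packet that non-preemptive LGFS transmits: a busy link goes on with its current packet, an
idle link takes the freshest waiting packet. -/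
def lgfsServer {L : Type} (o : Snapshot L) (e : L) : Option ℕ :=
  match o.server e with
  | some p => some p
  | none => (o.waiting e).max

/-- The non-preemptive Last-Generated, First-Served policy.  When the buffer overflows, the
freshest packets are kept: a fresh packet replaces the oldest one in a full queue, and a packet
older than all those in a full queue is dropped. -/
noncomputable def nonPrmpLGFS {N : ℕ} (I : Network N) (Ξ : Type*) [MeasurableSpace Ξ] :
    Policy I Ξ where
  decide := fun _ _ o =>
    { server := lgfsServer o
      queue := fun e => keepFreshest (I.buffer e) (o.waiting e \ (lgfsServer o e).toFinset)
      wait := ⊤ }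
  server_mem := by
    intro u h o e p hp
    simp only [lgfsServer] at hp
    simp only [Snapshot.pool, Finset.mem_union, Option.mem_toFinset, Option.mem_def]
    split at hp
    · rename_i q hq
      right
      rw [hq, hp]
    · left
      exact Finset.mem_of_max hp
  queue_subset := by
    intro u h o e
    exact (keepFreshest_subset _ _).trans
      (Finset.sdiff_subset.trans Finset.subset_union_left)
  server_notMem := by
    intro u h o e p hp hmem
    have := keepFreshest_subset _ _ hmem
    rw [Finset.mem_sdiff] at this
    apply this.2
    simpa using hp
  card_le := by
    intro u h o e
    exact card_keepFreshest_le _ _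
  measurable_server := by
    intro n d o e p
    exact MeasurableSet.const _
  measurable_queue := by
    intro n d o e S
    exact MeasurableSet.const _
  measurable_wait := by
    intro n d o
    exact measurable_const

end AgeNet

/-! Fix s and let Q be the set of packets generated at time s or later. The age of a node at time t
is the length of the set of s in [0, t] for which no packet of Q has arrived there by time t. By
Tonelli, the expected integral of the age over [0, T] is the integral over s of the mean time in [s,
T] before the first arrival of a packet of Q (`lintegral_ageIndicator`). So it suffices to compare
these arrival times for each fixed s. Only tail probabilities and means are compared; no coupling of
two policies is needed.

Lower bound for an arbitrary policy (`RandomTimes.tail_le_hitTime`): let a be the first arrival time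
of a packet of Q at the gateway. By time t the first link can have spent at most t − a on packets of
Q, split into shares w_i of several transmission times X_i. As long as every X_i exceeds its share,
no packet of Q is delivered and the run does not depend on the X_i. By independence and NBU this has
probability at least ∏ P(X > w_i) ≥ P(X > t − a). Hence delivery over the first link is
stochastically no earlier than a + X.

Upper bound for non-preemptive LGFS (`RandomTimes.residual_le`): once a packet of Q is at a link,
the link starts to send one no later than the end of the transmission in progress. If that
transmission has lasted τ, then P(X > τ + d) ≤ P(X > τ) P(X > d), so the residual time is
stochastically at most X. On the first link, LGFS therefore starts to send stochastically no later
than any policy delivers (`RandomTimes.tail_service_le`). What remains is one mean transmission time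
on the first link, and a wait plus a transmission on each later link
(`RandomTimes.meanTimeBefore_path_le`). -/

namespace AgeNet

/-! ### Invariants and monotonicity of runs under an arbitrary policy; hitting times. -/

section RunInvariants

variable {N : ℕ} {I : Network N} {Ξ : Type*} [MeasurableSpace Ξ]
  {π : Policy I Ξ} {u : Ξ} {mode : Preemption} {x : I.Link → ℕ → ℕ → ℝ≥0} {σ : State I}

theorem Network.mem_arrivedBy (I : Network N) {T : ℝ≥0} {l : ℕ} :
    l ∈ I.arrivedBy T ↔ I.arr l ≤ T := by
  simp [Network.arrivedBy]

/-- An infimum of arrival times is attained, since finitely many packets arrive in bounded time. -/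
theorem Network.exists_arr_le (I : Network N) {S : Set ℕ} {T : ℝ≥0}
    (h : (⨅ l ∈ S, I.arr l) ≤ T) : ∃ l ∈ S, I.arr l ≤ T := by
  classical
  by_contra! hc
  -- Cutting at T + 1 leaves finitely many packets, and all others are bounded away from T.
  let F := (I.arrivedBy (T + 1)).filter (· ∈ S)
  have h1 : (T : ℝ≥0∞) < min (F.inf I.arr) ((T + 1 : ℝ≥0) : ℝ≥0∞) := by
    refine lt_min ((Finset.lt_inf_iff (by simp)).2 fun l hl => hc l (Finset.mem_filter.1 hl).2) ?_
    exact_mod_cast lt_add_one T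
  refine absurd (h1.trans_le (le_iInf₂ fun l hl => ?_)) (not_lt.2 h)
  by_cases hl' : I.arr l ≤ ((T + 1 : ℝ≥0) : ℝ≥0∞)
  · exact (min_le_left _ _).trans
      (Finset.inf_le (Finset.mem_filter.2 ⟨I.mem_arrivedBy.2 hl', hl⟩))
  · exact (min_le_right _ _).trans (not_le.1 hl').le

theorem State.mem_done {T : ℝ≥0} {e : I.Link} :
    e ∈ σ.done mode x T ↔ σ.completion mode x e ≤ T := by
  simp [State.done]

/-- The time at which the current transmission ends depends on the transmission in progress and on
the earlier work on its packet only. -/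
theorem State.completion_congr {σ σ' : State I} {e : I.Link} (h1 : σ.server e = σ'.server e)
    (h2 : σ.since e = σ'.since e)
    (h3 : ∀ p, σ.server e = some p → σ.served e p = σ'.served e p ∧ σ.tries e p = σ'.tries e p) :
    σ.completion mode x e = σ'.completion mode x e := by
  cases hs : σ.server e with
  | none => simp [State.completion, hs, ← h1]
  | some p =>
    obtain ⟨h4, h5⟩ := h3 p hs
    cases mode <;> simp [State.completion, hs, ← h1, h2, h4, h5]

theorem State.since_le_completion (σ : State I) (e : I.Link) :
    (σ.since e : ℝ≥0∞) ≤ σ.completion mode x e := by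
  cases hs : σ.server e with
  | none => simp [State.completion, hs]
  | some p => cases mode <;> simp [State.completion, hs]

/-- A packet that has arrived at the origin of a link and is neither waiting nor in transmission
there. -/
def State.gone (σ : State I) (e : I.Link) : Finset ℕ :=
  σ.seen (I.src e) \ (σ.queue e ∪ (σ.server e).toFinset)

theorem State.mem_gone {e : I.Link} {p : ℕ} :
    p ∈ σ.gone e ↔ p ∈ σ.seen (I.src e) ∧ p ∉ σ.queue e ∧ σ.server e ≠ some p := by
  simp [State.gone, not_or]

variable [NeZero N]

/-- Invariants of the states that a run visits. -/
structure State.Valid (mode : Preemption) (x : I.Link → ℕ → ℕ → ℝ≥0) (σ : State I) : Prop where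
  arr_le : ∀ j, ∀ l ∈ σ.seen j, I.arr l ≤ σ.time
  le_arr : ∀ l, l ∉ σ.seen 0 → (σ.time : ℝ≥0∞) ≤ I.arr l
  queue_seen : ∀ e, σ.queue e ⊆ σ.seen (I.src e)
  server_seen : ∀ e p, σ.server e = some p → p ∈ σ.seen (I.src e)
  server_notMem : ∀ e p, σ.server e = some p → p ∉ σ.queue e
  since_le : ∀ e, σ.since e ≤ σ.time
  le_completion : ∀ e, (σ.time : ℝ≥0∞) ≤ σ.completion mode x e
  le_alarm : (σ.time : ℝ≥0∞) ≤ σ.alarm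

theorem State.valid_empty (mode : Preemption) (x : I.Link → ℕ → ℕ → ℝ≥0) :
    (State.empty I).Valid mode x := by
  constructor <;> simp [State.empty, State.completion]

theorem State.Valid.le_nextTime (h : σ.Valid mode x) : (σ.time : ℝ≥0∞) ≤ σ.nextTime mode x :=
  le_min (le_iInf₂ fun l hl => h.le_arr l hl) (le_min (le_iInf h.le_completion) h.le_alarm)

theorem State.seen_subset_seenAfter (σ : State I) (A : Finset ℕ) (D : Finset I.Link) (j : Fin N) :
    σ.seen j ⊆ σ.seenAfter A D j := by
  intro l hl
  simp [State.seenAfter, hl]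

theorem State.mem_seenAfter {A : Finset ℕ} {D : Finset I.Link} {j : Fin N} {l : ℕ} :
    l ∈ σ.seenAfter A D j ↔
      l ∈ σ.seen j ∨ (j = 0 ∧ l ∈ A) ∨ ∃ e ∈ D, I.dst e = j ∧ σ.server e = some l := by
  simp only [State.seenAfter, Finset.mem_union, Finset.mem_biUnion, Finset.mem_filter,
    Option.mem_toFinset, Option.mem_def, or_assoc, and_assoc]
  refine or_congr Iff.rfl (or_congr ?_ Iff.rfl)
  split_ifs with h <;> simp [h]

theorem State.snapshot_server_eq_some {A : Finset ℕ} {D : Finset I.Link} {e : I.Link} {p : ℕ} :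
    (σ.snapshot A D).server e = some p ↔ e ∉ D ∧ σ.server e = some p := by
  simp only [State.snapshot]
  split_ifs with h <;> simp [h]

theorem State.mem_snapshot_waiting {A : Finset ℕ} {D : Finset I.Link} {e : I.Link} {p : ℕ} :
    p ∈ (σ.snapshot A D).waiting e ↔
      p ∈ σ.queue e ∨ (p ∈ σ.seenAfter A D (I.src e) ∧ p ∉ σ.seen (I.src e)) := by
  simp [State.snapshot]

theorem Snapshot.mem_pool {L : Type} {o : Snapshot L} {e : L} {p : ℕ} :
    p ∈ o.pool e ↔ p ∈ o.waiting e ∨ o.server e = some p := by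
  simp [Snapshot.pool]

theorem State.Valid.pool_seen (h : σ.Valid mode x) {A : Finset ℕ} {D : Finset I.Link} {e : I.Link}
    {p : ℕ} (hp : p ∈ (σ.snapshot A D).pool e) : p ∈ σ.seenAfter A D (I.src e) := by
  rcases Snapshot.mem_pool.1 hp with hp | hp
  · rcases State.mem_snapshot_waiting.1 hp with hp | hp
    · exact σ.seen_subset_seenAfter _ _ _ (h.queue_seen e hp)
    · exact hp.1
  · exact σ.seen_subset_seenAfter _ _ _ (h.server_seen e p (State.snapshot_server_eq_some.1 hp).2)

theorem State.nextTime_le_arr {l : ℕ} (hl : l ∉ σ.seen 0) : σ.nextTime mode x ≤ I.arr l :=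
  (min_le_left _ _).trans (iInf₂_le l hl)

theorem State.nextTime_le_completion (e : I.Link) :
    σ.nextTime mode x ≤ σ.completion mode x e :=
  (min_le_right _ _).trans ((min_le_left _ _).trans (iInf_le _ e))

/-- The delicate field is `le_completion`. A transmission that goes on keeps its end, which lies
after `T` because the link is not in `done`; otherwise `since` is reset to `T`, and no transmission
ends before it starts. -/
theorem State.Valid.advance (h : σ.Valid mode x) (π : Policy I Ξ) (u : Ξ) {T : ℝ≥0}
    (hT : σ.nextTime mode x = T) : (σ.advance π u mode x T).Valid mode x := by
  have hle : σ.time ≤ T := by exact_mod_cast hT ▸ h.le_nextTime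
  have harr : ∀ j, ∀ l ∈ σ.seen j, I.arr l ≤ T := fun j l hl =>
    (h.arr_le j l hl).trans (by exact_mod_cast hle)
  constructor
  · intro j l hl
    rcases State.mem_seenAfter.1 hl with hl | ⟨-, hl⟩ | ⟨e, -, -, hl⟩
    · exact harr j l hl
    · exact I.mem_arrivedBy.1 (Finset.mem_sdiff.1 hl).1
    · exact harr _ l (h.server_seen e l hl)
  · intro l hl
    refine le_of_lt (not_le.1 fun hc => hl (State.mem_seenAfter.2 ?_))
    by_cases hl' : l ∈ σ.seen 0
    · exact Or.inl hl'
    · exact Or.inr (Or.inl ⟨rfl, Finset.mem_sdiff.2 ⟨I.mem_arrivedBy.2 hc, hl'⟩⟩)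
  · intro e p hp
    exact h.pool_seen (π.queue_subset _ _ _ e hp)
  · intro e p hp
    exact h.pool_seen (π.server_mem _ _ _ e p hp)
  · intro e p hp
    exact π.server_notMem _ _ _ e p hp
  · intro e
    simp only [State.advance]
    split_ifs
    · exact (h.since_le e).trans hle
    · exact le_rfl
  · intro e
    by_cases hs : (σ.snapshot (σ.fresh T) (σ.done mode x T)).server e
        = (σ.advance π u mode x T).server e
    · cases hp : (σ.advance π u mode x T).server e with
      | none => simp [State.completion, hp]
      | some p =>
        have hp' := hs.trans hp
        obtain ⟨hd, hp''⟩ := State.snapshot_server_eq_some.1 hp'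
        have : (σ.advance π u mode x T).completion mode x e = σ.completion mode x e := by
          apply State.completion_congr
          · rw [hp, hp'']
          · have : (σ.advance π u mode x T).since e = σ.since e := if_pos hs
            exact this
          · intro q hq
            rw [hp] at hq
            cases hq
            have hnp : ¬ preempts (σ.snapshot (σ.fresh T) (σ.done mode x T)) (π.decide u
                ((T, σ.fresh T, σ.done mode x T) :: σ.history)
                (σ.snapshot (σ.fresh T) (σ.done mode x T))) e p := fun hc => hc.2 hp
            exact ⟨if_neg hnp, if_neg hnp⟩
        rw [this]
        exact (not_le.1 fun hc => hd (State.mem_done.2 hc)).le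
    · have : (σ.advance π u mode x T).since e = T := if_neg hs
      have h2 := State.since_le_completion (mode := mode) (x := x) (σ.advance π u mode x T) e
      rwa [this] at h2
  · exact le_self_add

theorem State.step_eq_of_top {π : Policy I Ξ} {u : Ξ} (h : σ.nextTime mode x = ⊤) :
    σ.step π u mode x = σ := if_pos h

theorem State.step_eq_advance {π : Policy I Ξ} {u : Ξ} {T : ℝ≥0} (h : σ.nextTime mode x = T) :
    σ.step π u mode x = σ.advance π u mode x T := by
  simp [State.step, h]

theorem State.Valid.step (h : σ.Valid mode x) (π : Policy I Ξ) (u : Ξ) :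
    (σ.step π u mode x).Valid mode x := by
  by_cases hT : σ.nextTime mode x = ⊤
  · rwa [State.step_eq_of_top hT]
  · obtain ⟨T, hT⟩ := WithTop.ne_top_iff_exists.1 hT
    rw [State.step_eq_advance hT.symm]
    exact h.advance π u hT.symm

theorem State.seen_subset_step (π : Policy I Ξ) (u : Ξ) (j : Fin N) :
    σ.seen j ⊆ (σ.step π u mode x).seen j := by
  by_cases hT : σ.nextTime mode x = ⊤
  · rw [State.step_eq_of_top hT]
  · obtain ⟨T, hT⟩ := WithTop.ne_top_iff_exists.1 hT
    rw [State.step_eq_advance hT.symm]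
    exact σ.seen_subset_seenAfter _ _ _

theorem State.Valid.time_le_step (h : σ.Valid mode x) (π : Policy I Ξ) (u : Ξ) :
    σ.time ≤ (σ.step π u mode x).time := by
  by_cases hT : σ.nextTime mode x = ⊤
  · rw [State.step_eq_of_top hT]
  · obtain ⟨T, hT⟩ := WithTop.ne_top_iff_exists.1 hT
    rw [State.step_eq_advance hT.symm]
    have := h.le_nextTime
    rw [← hT] at this
    exact ENNReal.coe_le_coe.1 this

/-- A packet becomes available to a link only on its first arrival at the origin. Once it has been
seen there and is no longer in the pool, no policy can bring it back; hence `gone` can only grow. -/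
theorem State.mem_gone_advance {π : Policy I Ξ} {u : Ξ} {T : ℝ≥0} {e : I.Link} {p : ℕ}
    (hp : p ∈ σ.seen (I.src e)) (hq : p ∉ σ.queue e)
    (hs : e ∈ σ.done mode x T ∨ σ.server e ≠ some p) : p ∈ (σ.advance π u mode x T).gone e := by
  have hpool : p ∉ (σ.snapshot (σ.fresh T) (σ.done mode x T)).pool e := by
    intro hc
    rcases Snapshot.mem_pool.1 hc with hc | hc
    · rcases State.mem_snapshot_waiting.1 hc with hc | hc
      · exact hq hc
      · exact hc.2 hp
    · have := State.snapshot_server_eq_some.1 hc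
      tauto
  refine State.mem_gone.2 ⟨σ.seen_subset_seenAfter _ _ _ hp, fun hc => hpool ?_, fun hc => hpool ?_⟩
  · exact π.queue_subset _ _ _ e hc
  · exact π.server_mem _ _ _ e p hc

theorem State.gone_subset_step (π : Policy I Ξ) (u : Ξ) (e : I.Link) :
    σ.gone e ⊆ (σ.step π u mode x).gone e := by
  by_cases hT : σ.nextTime mode x = ⊤
  · rw [State.step_eq_of_top hT]
  · obtain ⟨T, hT⟩ := WithTop.ne_top_iff_exists.1 hT
    rw [State.step_eq_advance hT.symm]
    intro p hp
    obtain ⟨h1, h2, h3⟩ := State.mem_gone.1 hp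
    exact State.mem_gone_advance h1 h2 (Or.inr h3)

/-- Time of the next epoch if the transmission over link `e` were never to end. -/
noncomputable def State.nextTimeOff (σ : State I) (mode : Preemption)
    (x : I.Link → ℕ → ℕ → ℝ≥0) (e : I.Link) : ℝ≥0∞ :=
  min (⨅ l ∈ {l : ℕ | l ∉ σ.seen 0}, I.arr l)
    (min (⨅ f, ⨅ (_ : f ≠ e), σ.completion mode x f) σ.alarm)

theorem State.nextTime_eq_min (σ : State I) (mode : Preemption) (x : I.Link → ℕ → ℕ → ℝ≥0)
    (e : I.Link) :
    σ.nextTime mode x = min (σ.nextTimeOff mode x e) (σ.completion mode x e) := by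
  have hspl : (⨅ f, σ.completion mode x f)
      = min (⨅ f, ⨅ (_ : f ≠ e), σ.completion mode x f) (σ.completion mode x e) := by
    apply le_antisymm
    · exact le_min (le_iInf₂ fun f _ => iInf_le _ f) (iInf_le _ e)
    · refine le_iInf fun f => ?_
      by_cases hf : f = e
      · rw [hf]; exact min_le_right _ _
      · exact (min_le_left _ _).trans (iInf₂_le f hf)
  rw [State.nextTimeOff, State.nextTime, hspl]
  rw [← min_assoc, ← min_assoc, ← min_assoc, min_right_comm]

theorem State.nextTimeOff_congr {x' : I.Link → ℕ → ℕ → ℝ≥0} {e : I.Link}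
    (h : ∀ f, f ≠ e → σ.completion mode x f = σ.completion mode x' f) :
    σ.nextTimeOff mode x e = σ.nextTimeOff mode x' e := by
  have hcong : (⨅ f, ⨅ (_ : f ≠ e), σ.completion mode x f)
      = ⨅ f, ⨅ (_ : f ≠ e), σ.completion mode x' f :=
    iInf_congr fun f => iInf_congr fun hf => h f hf
  rw [State.nextTimeOff, State.nextTimeOff, hcong]

/-- Two families of transmission times give the same next state if they differ only on a link
whose transmission is not the first to end. -/
theorem State.step_congr (π : Policy I Ξ) (u : Ξ) {x' : I.Link → ℕ → ℕ → ℝ≥0} (e : I.Link)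
    (h : ∀ f, f ≠ e → σ.completion mode x f = σ.completion mode x' f)
    (h1 : σ.completion mode x e = σ.completion mode x' e ∨
      (σ.nextTime mode x < σ.completion mode x e ∧ σ.nextTime mode x < σ.completion mode x' e)) :
    σ.step π u mode x = σ.step π u mode x' ∧ σ.nextTime mode x = σ.nextTime mode x' := by
  have key : σ.nextTime mode x = σ.nextTime mode x' := by
    rw [σ.nextTime_eq_min mode x e] at h1 ⊢
    rw [σ.nextTime_eq_min mode x' e, ← State.nextTimeOff_congr h]
    rcases h1 with h1 | ⟨h1, h2⟩
    · rw [h1]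
    · have h3 : σ.nextTimeOff mode x e ≤ σ.completion mode x e :=
        not_lt.1 fun hc => absurd h1 (by simp [min_eq_right hc.le])
      rw [min_eq_left h3] at h2 ⊢
      rw [min_eq_left h2.le]
  refine ⟨?_, key⟩
  by_cases hT : σ.nextTime mode x = ⊤
  · rw [State.step_eq_of_top hT, State.step_eq_of_top (key ▸ hT)]
  · obtain ⟨T, hT⟩ := WithTop.ne_top_iff_exists.1 hT
    have hd : σ.done mode x T = σ.done mode x' T := by
      ext f
      rw [State.mem_done, State.mem_done]
      by_cases hf : f = e
      · rw [hf]
        rcases h1 with h2 | ⟨h2, h3⟩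
        · rw [h2]
        · rw [← hT] at h2 h3
          exact ⟨fun hc => absurd hc (not_le.2 h2), fun hc => absurd hc (not_le.2 h3)⟩
      · rw [h f hf]
    rw [State.step_eq_advance hT.symm, State.step_eq_advance (hT.trans key).symm]
    unfold State.advance
    rw [hd]

variable (π u mode x)

theorem run_zero : run π u mode x 0 = State.empty I := rfl

theorem run_succ (n : ℕ) : run π u mode x (n + 1) = (run π u mode x n).step π u mode x :=
  Function.iterate_succ_apply' _ _ _

theorem valid_run (n : ℕ) : (run π u mode x n).Valid mode x := by
  induction n with
  | zero => exact State.valid_empty mode x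
  | succ n ih => rw [run_succ]; exact ih.step π u

theorem monotone_time : Monotone fun n => (run π u mode x n).time :=
  monotone_nat_of_le_succ fun n => by
    rw [run_succ]; exact (valid_run π u mode x n).time_le_step π u

theorem monotone_seen (j : Fin N) : Monotone fun n => (run π u mode x n).seen j :=
  monotone_nat_of_le_succ fun n => by
    rw [run_succ]; exact State.seen_subset_step π u j

theorem monotone_gone (e : I.Link) : Monotone fun n => (run π u mode x n).gone e :=
  monotone_nat_of_le_succ fun n => by
    rw [run_succ]; exact State.gone_subset_step π u e

/-- The first time at which the state of the system has the property `P`. -/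
noncomputable def hitTime (P : State I → Prop) : ℝ≥0∞ :=
  ⨅ n, ⨅ (_ : P (run π u mode x n)), ((run π u mode x n).time : ℝ≥0∞)

variable {π u mode x}

theorem hitTime_le {P : State I → Prop} {n : ℕ} (h : P (run π u mode x n)) :
    hitTime π u mode x P ≤ (run π u mode x n).time := iInf₂_le n h

/-- The property holds for the first time at the hitting time. -/
theorem exists_hitTime_eq {P : State I → Prop} (h : hitTime π u mode x P ≠ ⊤) :
    ∃ n, P (run π u mode x n) ∧ (∀ i < n, ¬ P (run π u mode x i)) ∧
      hitTime π u mode x P = (run π u mode x n).time := by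
  classical
  have hex : ∃ n, P (run π u mode x n) := by
    by_contra! hc
    exact h (by simp [hitTime, hc])
  refine ⟨Nat.find hex, Nat.find_spec hex, fun i hi => Nat.find_min hex hi,
    le_antisymm (hitTime_le (Nat.find_spec hex)) (le_iInf₂ fun i hi => ?_)⟩
  exact_mod_cast monotone_time π u mode x (Nat.find_min' hex hi)

theorem hitTime_le_iff {P : State I → Prop} {t : ℝ≥0} :
    hitTime π u mode x P ≤ t ↔ ∃ n, P (run π u mode x n) ∧ (run π u mode x n).time ≤ t := by
  constructor
  · intro h
    obtain ⟨n, h1, -, h2⟩ := exists_hitTime_eq (ne_top_of_le_ne_top ENNReal.coe_ne_top h)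
    exact ⟨n, h1, by rw [h2] at h; exact_mod_cast h⟩
  · rintro ⟨n, h1, h2⟩
    exact (hitTime_le h1).trans (by exact_mod_cast h2)

/-- A packet of `Q` has arrived at node `j`. -/
def SeenAt (j : Fin N) (Q : Set ℕ) (σ : State I) : Prop := ∃ l ∈ σ.seen j, l ∈ Q

/-- A packet of `Q` is in transmission over link `e`. -/
def ServedOn (e : I.Link) (Q : Set ℕ) (σ : State I) : Prop := ∃ l, σ.server e = some l ∧ l ∈ Q

/-- A packet can reach a node other than the gateway over its incoming link only. -/
theorem seen_src_of_seen_dst (hin : I.SingleIn) {e : I.Link} (he : I.dst e ≠ 0) {n l : ℕ}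
    (h : l ∈ (run π u mode x n).seen (I.dst e)) : l ∈ (run π u mode x n).seen (I.src e) := by
  induction n with
  | zero => simp [run_zero, State.empty] at h
  | succ n ih =>
    have hsub := monotone_seen π u mode x (I.src e) n.le_succ
    by_cases hl : l ∈ (run π u mode x n).seen (I.dst e)
    · exact hsub (ih hl)
    · by_cases hT : (run π u mode x n).nextTime mode x = ⊤
      · rw [run_succ, State.step_eq_of_top hT] at h
        exact absurd h hl
      · obtain ⟨T, hT⟩ := WithTop.ne_top_iff_exists.1 hT
        rw [run_succ, State.step_eq_advance hT.symm] at h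
        rcases State.mem_seenAfter.1 h with h | h | ⟨f, -, h2, h3⟩
        · exact absurd h hl
        · exact absurd h.1 he
        · have hfe : f = e := (hin _ he).unique h2 rfl
          subst hfe
          exact hsub ((valid_run π u mode x n).server_seen _ _ h3)

end RunInvariants

/-- The freshest packet of `S` survives in any buffer with at least one place. This is where the
assumption on the buffer sizes enters. -/
theorem exists_mem_keepFreshest {B : ℕ∞} (hB : 1 ≤ B) {S : Finset ℕ} {q : ℕ} (hq : q ∈ S) :
    ∃ q' ∈ keepFreshest B S, q ≤ q' := by
  classical
  have hS : S.Nonempty := ⟨q, hq⟩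
  refine ⟨S.max' hS, Finset.mem_filter.2 ⟨S.max'_mem hS, ?_⟩, S.le_max' q hq⟩
  have : S.filter (fun r => S.max' hS < r) = ∅ :=
    Finset.filter_eq_empty_iff.2 fun r hr => not_lt.2 (S.le_max' r hr)
  have h0 : (0 : ℕ∞) < B := lt_of_lt_of_le (by simp) hB
  convert h0
  exact_mod_cast congrArg Finset.card this

/-! ### Sample-path properties of the non-preemptive LGFS policy. -/

section LGFS

variable {N : ℕ} [NeZero N] {I : Network N} {Ξ : Type*} [MeasurableSpace Ξ]
  {u : Ξ} {mode : Preemption} {x : I.Link → ℕ → ℕ → ℝ≥0} {σ : State I}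

theorem nextTime_le_nextTime_succ (π : Policy I Ξ) (n : ℕ) :
    (run π u mode x n).nextTime mode x ≤ (run π u mode x (n + 1)).nextTime mode x := by
  by_cases hT : (run π u mode x n).nextTime mode x = ⊤
  · rw [run_succ, State.step_eq_of_top hT]
  · obtain ⟨T, hT⟩ := WithTop.ne_top_iff_exists.1 hT
    have h := (valid_run π u mode x (n + 1)).le_nextTime
    have h2 : (run π u mode x (n + 1)).time = T := by
      rw [run_succ, State.step_eq_advance hT.symm]; rfl
    rw [h2] at h
    rw [← hT]
    exact h

theorem monotone_nextTime (π : Policy I Ξ) :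
    Monotone fun n => (run π u mode x n).nextTime mode x :=
  monotone_nat_of_le_succ fun n => nextTime_le_nextTime_succ π n

/-- The non-preemptive policy never resumes or repeats a transmission, and takes decisions only
when a packet arrives or a transmission ends. -/
theorem lgfs_no_preemption (n : ℕ) :
    (∀ e p, (run (nonPrmpLGFS I Ξ) u mode x n).served e p = 0) ∧
      (∀ e p, (run (nonPrmpLGFS I Ξ) u mode x n).tries e p = 0) ∧
      (run (nonPrmpLGFS I Ξ) u mode x n).alarm = ⊤ ∧
      (∀ e, (run (nonPrmpLGFS I Ξ) u mode x n).server e = none →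
        (run (nonPrmpLGFS I Ξ) u mode x n).queue e = ∅) := by
  induction n with
  | zero => simp [run_zero, State.empty]
  | succ n ih =>
    by_cases hT : (run (nonPrmpLGFS I Ξ) u mode x n).nextTime mode x = ⊤
    · rwa [run_succ, State.step_eq_of_top hT]
    · obtain ⟨T, hT⟩ := WithTop.ne_top_iff_exists.1 hT
      rw [run_succ, State.step_eq_advance hT.symm]
      obtain ⟨h1, h2, h3, h4⟩ := ih
      have hnp : ∀ (o : Snapshot I.Link) (h : History I.Link) e p,
          ¬ preempts o ((nonPrmpLGFS I Ξ).decide u h o) e p := by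
        rintro o h e p ⟨h5, h6⟩
        apply h6
        change lgfsServer o e = some p
        rw [lgfsServer, h5]
      refine ⟨fun e p => (if_neg (hnp _ _ e p)).trans (h1 e p),
        fun e p => (if_neg (hnp _ _ e p)).trans (h2 e p), ?_, fun e he => ?_⟩
      · change (T : ℝ≥0∞) + ⊤ = ⊤
        simp
      · change lgfsServer _ e = none at he
        rw [lgfsServer] at he
        split at he
        · cases he
        · have hw := Finset.max_eq_bot.1 he
          apply Finset.subset_empty.1
          refine ((keepFreshest_subset _ _).trans Finset.sdiff_subset).trans ?_
          rw [hw]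

/-- Without preemption the three conventions coincide, and only the draw with index 0 matters. The
times `y` need not be those that produced the state, so that two families can be compared from one
state. -/
theorem lgfs_completion {n : ℕ} {e : I.Link} {p : ℕ}
    (h : (run (nonPrmpLGFS I Ξ) u mode x n).server e = some p) (y : I.Link → ℕ → ℕ → ℝ≥0) :
    (run (nonPrmpLGFS I Ξ) u mode x n).completion mode y e
      = (((run (nonPrmpLGFS I Ξ) u mode x n).since e + y e p 0 : ℝ≥0) : ℝ≥0∞) := by
  obtain ⟨h1, h2, -, -⟩ := lgfs_no_preemption (I := I) (u := u) (mode := mode) (x := x) n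
  cases mode <;> simp [State.completion, h, h1, h2]

/-- A busy link goes on with its transmission. -/
theorem lgfs_continue {T : ℝ≥0} {e : I.Link} {p : ℕ} (h : σ.server e = some p)
    (hd : e ∉ σ.done mode x T) :
    (σ.advance (nonPrmpLGFS I Ξ) u mode x T).server e = some p ∧
      (σ.advance (nonPrmpLGFS I Ξ) u mode x T).since e = σ.since e := by
  have h1 := (State.snapshot_server_eq_some (A := σ.fresh T)).2 ⟨hd, h⟩
  have h2 : (σ.advance (nonPrmpLGFS I Ξ) u mode x T).server e = some p := by
    change lgfsServer _ e = some p
    rw [lgfsServer, h1]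
  exact ⟨h2, if_pos (h1.trans h2.symm)⟩

/-- Since `gone` is permanent, a link sends a packet only once; two epochs at which it is sending
`p` belong to the same transmission. -/
theorem lgfs_persist {i : ℕ} {e : I.Link} {p : ℕ}
    (h : (run (nonPrmpLGFS I Ξ) u mode x i).server e = some p) {n : ℕ} (hn : i ≤ n) :
    ((run (nonPrmpLGFS I Ξ) u mode x n).server e = some p ∧
      (run (nonPrmpLGFS I Ξ) u mode x n).since e = (run (nonPrmpLGFS I Ξ) u mode x i).since e) ∨
      p ∈ (run (nonPrmpLGFS I Ξ) u mode x n).gone e := by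
  induction n, hn using Nat.le_induction with
  | base => exact Or.inl ⟨h, rfl⟩
  | succ n hn ih =>
    rcases ih with ⟨ih1, ih2⟩ | ih
    · by_cases hT : (run (nonPrmpLGFS I Ξ) u mode x n).nextTime mode x = ⊤
      · rw [run_succ, State.step_eq_of_top hT]
        exact Or.inl ⟨ih1, ih2⟩
      · obtain ⟨T, hT⟩ := WithTop.ne_top_iff_exists.1 hT
        rw [run_succ, State.step_eq_advance hT.symm]
        by_cases hd : e ∈ (run (nonPrmpLGFS I Ξ) u mode x n).done mode x T
        · have hv := valid_run (nonPrmpLGFS I Ξ) u mode x n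
          exact Or.inr (State.mem_gone_advance (hv.server_seen e p ih1)
            (hv.server_notMem e p ih1) (Or.inl hd))
        · obtain ⟨h1, h2⟩ := lgfs_continue (u := u) ih1 hd
          exact Or.inl ⟨h1, h2.trans ih2⟩
    · exact Or.inr (monotone_gone _ _ _ _ e n.le_succ ih)

/-- Number of arrivals at the gateway and of packets that have left a link. -/
def State.progress (σ : State I) : ℕ := (σ.seen 0).card + ∑ e, (σ.gone e).card

/-- As `alarm` is always `⊤`, an epoch is an arrival at the gateway, which enlarges `seen 0`, or the
end of a transmission, which enlarges `gone` for that link. None of these sets ever shrinks. -/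
theorem lgfs_progress {n : ℕ} {T : ℝ≥0}
    (hT : (run (nonPrmpLGFS I Ξ) u mode x n).nextTime mode x ≤ T) :
    (run (nonPrmpLGFS I Ξ) u mode x n).progress + 1
      ≤ (run (nonPrmpLGFS I Ξ) u mode x (n + 1)).progress := by
  obtain ⟨T', hT'⟩ := WithTop.ne_top_iff_exists.1 (ne_top_of_le_ne_top ENNReal.coe_ne_top hT)
  have hs : (run (nonPrmpLGFS I Ξ) u mode x n).seen 0
      ⊆ (run (nonPrmpLGFS I Ξ) u mode x (n + 1)).seen 0 :=
    monotone_seen (nonPrmpLGFS I Ξ) u mode x 0 n.le_succ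
  have hg : ∀ e, (run (nonPrmpLGFS I Ξ) u mode x n).gone e
      ⊆ (run (nonPrmpLGFS I Ξ) u mode x (n + 1)).gone e :=
    fun e => monotone_gone (nonPrmpLGFS I Ξ) u mode x e n.le_succ
  have hv := valid_run (nonPrmpLGFS I Ξ) u mode x n
  obtain ⟨-, -, hal, -⟩ := lgfs_no_preemption (I := I) (Ξ := Ξ) (u := u) (mode := mode) (x := x) n
  have hrun : run (nonPrmpLGFS I Ξ) u mode x (n + 1)
      = (run (nonPrmpLGFS I Ξ) u mode x n).advance (nonPrmpLGFS I Ξ) u mode x T' := by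
    rw [run_succ, State.step_eq_advance hT'.symm]
  by_cases hd : ∃ e, (run (nonPrmpLGFS I Ξ) u mode x n).completion mode x e ≤ T'
  · obtain ⟨e, he⟩ := hd
    obtain ⟨p, hp⟩ : ∃ p, (run (nonPrmpLGFS I Ξ) u mode x n).server e = some p := by
      cases h : (run (nonPrmpLGFS I Ξ) u mode x n).server e with
      | none => simp [State.completion, h] at he
      | some p => exact ⟨p, rfl⟩
    have hlt : ((run (nonPrmpLGFS I Ξ) u mode x n).gone e).card
        < ((run (nonPrmpLGFS I Ξ) u mode x (n + 1)).gone e).card := by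
      refine Finset.card_lt_card ((Finset.ssubset_iff_of_subset (hg e)).2 ⟨p, ?_, ?_⟩)
      · rw [hrun]
        exact State.mem_gone_advance (hv.server_seen e p hp) (hv.server_notMem e p hp)
          (Or.inl (State.mem_done.2 he))
      · exact fun hc => (State.mem_gone.1 hc).2.2 hp
    have := Finset.sum_lt_sum (s := Finset.univ) (fun e _ => Finset.card_le_card (hg e))
      ⟨e, Finset.mem_univ e, hlt⟩
    have := Finset.card_le_card hs
    simp only [State.progress]
    omega
  · push Not at hd
    have hlt : ((run (nonPrmpLGFS I Ξ) u mode x n).seen 0).card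
        < ((run (nonPrmpLGFS I Ξ) u mode x (n + 1)).seen 0).card := by
      have hle : (⨅ l ∈ {l : ℕ | l ∉ (run (nonPrmpLGFS I Ξ) u mode x n).seen 0}, I.arr l) ≤ T' := by
        have h1 := hT'.symm
        change _ = (T' : ℝ≥0∞) at h1
        rw [State.nextTime, hal, min_top_right] at h1
        rcases min_choice (⨅ l ∈ {l : ℕ | l ∉ (run (nonPrmpLGFS I Ξ) u mode x n).seen 0}, I.arr l)
          (⨅ e, (run (nonPrmpLGFS I Ξ) u mode x n).completion mode x e) with h2 | h2
        · exact (h2.symm.trans h1).le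
        · rw [h2] at h1
          by_cases hne : Nonempty I.Link
          · obtain ⟨e, he⟩ := exists_eq_ciInf_of_finite
              (f := fun e => (run (nonPrmpLGFS I Ξ) u mode x n).completion mode x e)
            exact absurd (hd e) (not_lt.2 (he.trans h1).le)
          · rw [not_nonempty_iff] at hne
            rw [iInf_of_empty] at h1
            exact absurd h1 ENNReal.top_ne_coe
      obtain ⟨l, hl, hl'⟩ := I.exists_arr_le hle
      refine Finset.card_lt_card ((Finset.ssubset_iff_of_subset hs).2 ⟨l, ?_, hl⟩)
      rw [hrun]
      exact State.mem_seenAfter.2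
        (Or.inr (Or.inl ⟨rfl, Finset.mem_sdiff.2 ⟨I.mem_arrivedBy.2 hl', hl⟩⟩))
    have := Finset.sum_le_sum (s := Finset.univ) (fun e _ => Finset.card_le_card (hg e))
    simp only [State.progress]
    omega

theorem State.Valid.progress_le (h : σ.Valid mode x) {T : ℝ≥0} (hT : σ.time ≤ T) :
    σ.progress ≤ (I.arrivedBy T).card + ∑ _e : I.Link, (I.arrivedBy T).card := by
  have hs : ∀ j, σ.seen j ⊆ I.arrivedBy T := fun j l hl =>
    I.mem_arrivedBy.2 ((h.arr_le j l hl).trans (by exact_mod_cast hT))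
  exact Nat.add_le_add (Finset.card_le_card (hs 0)) (Finset.sum_le_sum fun e _ =>
    Finset.card_le_card (Finset.sdiff_subset.trans (hs _)))

/-- Under the non-preemptive policy, finitely many epochs take place in bounded time. -/
theorem lgfs_exists_lt_nextTime (u : Ξ) (mode : Preemption) (x : I.Link → ℕ → ℕ → ℝ≥0) (T : ℝ≥0) :
    ∃ n, (run (nonPrmpLGFS I Ξ) u mode x n).time ≤ T ∧
      (T : ℝ≥0∞) < (run (nonPrmpLGFS I Ξ) u mode x n).nextTime mode x := by
  classical
  have htime : ∀ n, (run (nonPrmpLGFS I Ξ) u mode x n).nextTime mode x ≤ T →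
      (run (nonPrmpLGFS I Ξ) u mode x (n + 1)).time ≤ T := by
    intro n hn
    obtain ⟨T', hT'⟩ := WithTop.ne_top_iff_exists.1 (ne_top_of_le_ne_top ENNReal.coe_ne_top hn)
    rw [run_succ, State.step_eq_advance hT'.symm]
    rw [← hT'] at hn
    exact ENNReal.coe_le_coe.1 hn
  have hex : ∃ n, (T : ℝ≥0∞) < (run (nonPrmpLGFS I Ξ) u mode x n).nextTime mode x := by
    by_contra! hc
    have hn : ∀ n, n ≤ (run (nonPrmpLGFS I Ξ) u mode x n).progress := by
      intro n
      induction n with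
      | zero => exact Nat.zero_le _
      | succ n ih => exact (Nat.succ_le_succ ih).trans (lgfs_progress (hc n))
    set K := (I.arrivedBy T).card + ∑ _e : I.Link, (I.arrivedBy T).card
    have h1 := hn (K + 1)
    have h2 := (valid_run (nonPrmpLGFS I Ξ) u mode x (K + 1)).progress_le (htime K (hc K))
    omega
  refine ⟨Nat.find hex, ?_, Nat.find_spec hex⟩
  rcases h : Nat.find hex with _ | n
  · simp [run_zero, State.empty]
  · exact htime n (not_lt.1 (Nat.find_min hex (h ▸ n.lt_succ_self)))

/-- Every transmission of the non-preemptive policy comes to its end. -/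
theorem lgfs_completes {n : ℕ} {e : I.Link} {p : ℕ}
    (h : (run (nonPrmpLGFS I Ξ) u mode x n).server e = some p) :
    ∃ i ≥ n, ∃ T : ℝ≥0, T ≤ (run (nonPrmpLGFS I Ξ) u mode x n).since e + x e p 0 ∧
      (run (nonPrmpLGFS I Ξ) u mode x i).server e = some p ∧
      e ∈ (run (nonPrmpLGFS I Ξ) u mode x i).done mode x T ∧
      run (nonPrmpLGFS I Ξ) u mode x (i + 1)
        = (run (nonPrmpLGFS I Ξ) u mode x i).advance (nonPrmpLGFS I Ξ) u mode x T := by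
  set c := (run (nonPrmpLGFS I Ξ) u mode x n).since e + x e p 0 with hc
  by_contra! hcon
  -- A transmission that never ended would keep every next epoch at or before `c`, although only
  -- finitely many epochs take place by then.
  have key : ∀ i ≥ n, (run (nonPrmpLGFS I Ξ) u mode x i).server e = some p ∧
      (run (nonPrmpLGFS I Ξ) u mode x i).since e = (run (nonPrmpLGFS I Ξ) u mode x n).since e := by
    intro i hi
    induction i, hi using Nat.le_induction with
    | base => exact ⟨h, rfl⟩
    | succ i hi ih =>
      have hle := State.nextTime_le_completion (σ := run (nonPrmpLGFS I Ξ) u mode x i)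
        (mode := mode) (x := x) e
      rw [lgfs_completion ih.1, ih.2] at hle
      obtain ⟨T, hT⟩ := WithTop.ne_top_iff_exists.1 (ne_top_of_le_ne_top ENNReal.coe_ne_top hle)
      have hrun : run (nonPrmpLGFS I Ξ) u mode x (i + 1)
          = (run (nonPrmpLGFS I Ξ) u mode x i).advance (nonPrmpLGFS I Ξ) u mode x T := by
        rw [run_succ, State.step_eq_advance hT.symm]
      rw [← hT] at hle
      by_cases hd : e ∈ (run (nonPrmpLGFS I Ξ) u mode x i).done mode x T
      · exact absurd hrun (hcon i hi T (ENNReal.coe_le_coe.1 hle) ih.1 hd)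
      · rw [hrun]
        obtain ⟨h1, h2⟩ := lgfs_continue (u := u) ih.1 hd
        exact ⟨h1, h2.trans ih.2⟩
  obtain ⟨M, -, hM⟩ := lgfs_exists_lt_nextTime (I := I) u mode x c
  have hM' := hM.trans_le (monotone_nextTime (nonPrmpLGFS I Ξ) (le_max_left M n))
  obtain ⟨h1, h2⟩ := key (max M n) (le_max_right _ _)
  have hle := State.nextTime_le_completion (σ := run (nonPrmpLGFS I Ξ) u mode x (max M n))
        (mode := mode) (x := x) e
  rw [lgfs_completion h1, h2] at hle
  exact absurd hle (not_le.2 hM')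

/-- A change of the transmission time of packet `p` over link `e` is not noticed as long as the
transmission goes on. -/
theorem lgfs_run_congr {x' : I.Link → ℕ → ℕ → ℝ≥0} {e : I.Link} {p : ℕ}
    (hx : ∀ f q, (f, q) ≠ (e, p) → x f q 0 = x' f q 0) {n : ℕ}
    (h : (run (nonPrmpLGFS I Ξ) u mode x n).server e = some p)
    (h' : x e p 0 ≤ x' e p 0 ∨ (run (nonPrmpLGFS I Ξ) u mode x n).time
      < (run (nonPrmpLGFS I Ξ) u mode x n).since e + x' e p 0) {i : ℕ} (hi : i ≤ n) :
    run (nonPrmpLGFS I Ξ) u mode x' i = run (nonPrmpLGFS I Ξ) u mode x i := by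
  induction i with
  | zero => rfl
  | succ i ih =>
    have ih := ih (by omega)
    rw [run_succ, run_succ, ih]
    have hcompl : ∀ f q, (run (nonPrmpLGFS I Ξ) u mode x i).server f = some q → (f, q) ≠ (e, p) →
        (run (nonPrmpLGFS I Ξ) u mode x i).completion mode x f
          = (run (nonPrmpLGFS I Ξ) u mode x i).completion mode x' f := by
      intro f q hq hne
      rw [lgfs_completion hq, lgfs_completion hq, hx f q hne]
    have hnone : ∀ f, (run (nonPrmpLGFS I Ξ) u mode x i).server f = none →
        (run (nonPrmpLGFS I Ξ) u mode x i).completion mode x f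
          = (run (nonPrmpLGFS I Ξ) u mode x i).completion mode x' f := by
      intro f hf
      simp [State.completion, hf]
    refine (State.step_congr (nonPrmpLGFS I Ξ) u e (fun f hf => ?_) ?_).1.symm
    · cases hs : (run (nonPrmpLGFS I Ξ) u mode x i).server f with
      | none => exact hnone f hs
      | some q => exact hcompl f q hs (by simp [hf])
    · cases hs : (run (nonPrmpLGFS I Ξ) u mode x i).server e with
      | none => exact Or.inl (hnone e hs)
      | some q =>
        by_cases hq : q = p
        · subst hq
          right
          have hle := State.nextTime_le_completion (σ := run (nonPrmpLGFS I Ξ) u mode x i)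
            (mode := mode) (x := x) e
          rw [lgfs_completion hs] at hle ⊢
          rw [lgfs_completion hs]
          obtain ⟨T, hT⟩ :=
            WithTop.ne_top_iff_exists.1 (ne_top_of_le_ne_top ENNReal.coe_ne_top hle)
          have hrun : run (nonPrmpLGFS I Ξ) u mode x (i + 1)
              = (run (nonPrmpLGFS I Ξ) u mode x i).advance (nonPrmpLGFS I Ξ) u mode x T := by
            rw [run_succ, State.step_eq_advance hT.symm]
          -- The packet is still in transmission at epoch `n`, so it cannot have left the link
          -- earlier; hence its transmission does not end at epoch `i + 1` under `x`.
          have hnotgone : ∀ j ≤ n, q ∉ (run (nonPrmpLGFS I Ξ) u mode x j).gone e := fun j hj hc =>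
            (State.mem_gone.1 (monotone_gone _ _ _ _ e hj hc)).2.2 h
          have hv := valid_run (nonPrmpLGFS I Ξ) u mode x i
          have hd : e ∉ (run (nonPrmpLGFS I Ξ) u mode x i).done mode x T := fun hd => by
            apply hnotgone (i + 1) hi
            rw [hrun]
            exact State.mem_gone_advance (hv.server_seen e q hs) (hv.server_notMem e q hs)
              (Or.inl hd)
          rw [State.mem_done, lgfs_completion hs, not_le] at hd
          rw [← hT]
          refine ⟨hd, ?_⟩
          -- Nor does it end there under `x'`: either its transmission time is at least as long, or
          -- it lasts beyond epoch `n`, counted from the same starting time.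
          rcases h' with h' | h'
          · refine hd.trans_le (ENNReal.coe_le_coe.2 ?_)
            gcongr
          · rcases lgfs_persist hs (show i ≤ n by omega) with ⟨-, h2⟩ | h2
            · rw [← h2]
              refine ENNReal.coe_lt_coe.2 (lt_of_le_of_lt ?_ h')
              have h3 := monotone_time (nonPrmpLGFS I Ξ) u mode x hi
              simp only [hrun] at h3
              exact h3
            · exact absurd h2 (hnotgone n le_rfl)
        · exact Or.inl (hcompl e q hs (by simp [hq]))

/-- When a fresh packet has arrived, the link keeps a fresh packet until it sends one. -/
theorem lgfs_waiting {Q : Set ℕ} (hQ : IsUpperSet Q) {e : I.Link} (hB : 1 ≤ I.buffer e) {n : ℕ}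
    (h : SeenAt (I.src e) Q (run (nonPrmpLGFS I Ξ) u mode x n)) :
    (∃ i ≤ n, ServedOn e Q (run (nonPrmpLGFS I Ξ) u mode x i)) ∨
      ∃ q ∈ (run (nonPrmpLGFS I Ξ) u mode x n).queue e, q ∈ Q := by
  induction n with
  | zero => simp [SeenAt, run_zero, State.empty] at h
  | succ n ih =>
    by_cases hT : (run (nonPrmpLGFS I Ξ) u mode x n).nextTime mode x = ⊤
    · rw [run_succ, State.step_eq_of_top hT] at h ⊢
      rcases ih h with ⟨i, hi, hi'⟩ | ih
      · exact Or.inl ⟨i, by omega, hi'⟩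
      · exact Or.inr ih
    · obtain ⟨T, hT⟩ := WithTop.ne_top_iff_exists.1 hT
      have hrun : run (nonPrmpLGFS I Ξ) u mode x (n + 1)
          = (run (nonPrmpLGFS I Ξ) u mode x n).advance (nonPrmpLGFS I Ξ) u mode x T := by
        rw [run_succ, State.step_eq_advance hT.symm]
      by_cases hs : ∃ i ≤ n, ServedOn e Q (run (nonPrmpLGFS I Ξ) u mode x i)
      · obtain ⟨i, hi, hi'⟩ := hs
        exact Or.inl ⟨i, by omega, hi'⟩
      set σ := run (nonPrmpLGFS I Ξ) u mode x n
      set o := σ.snapshot (σ.fresh T) (σ.done mode x T) with ho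
      have hw : ∃ q ∈ o.waiting e, q ∈ Q := by
        obtain ⟨l, hl, hlQ⟩ := h
        rw [hrun] at hl
        by_cases hl' : l ∈ σ.seen (I.src e)
        · rcases ih ⟨l, hl', hlQ⟩ with ih | ⟨q, hq, hqQ⟩
          · exact absurd ih hs
          · exact ⟨q, State.mem_snapshot_waiting.2 (Or.inl hq), hqQ⟩
        · exact ⟨l, State.mem_snapshot_waiting.2 (Or.inr ⟨hl, hl'⟩), hlQ⟩
      obtain ⟨q, hq, hqQ⟩ := hw
      have hserv : (σ.advance (nonPrmpLGFS I Ξ) u mode x T).server e = lgfsServer o e := rfl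
      have hqueue : (σ.advance (nonPrmpLGFS I Ξ) u mode x T).queue e
        = keepFreshest (I.buffer e) (o.waiting e \ (lgfsServer o e).toFinset) := rfl
      by_cases hsQ : ∃ l, lgfsServer o e = some l ∧ l ∈ Q
      · exact Or.inl ⟨n + 1, le_rfl, by rw [hrun]; exact hsQ⟩
      · right
        rw [hrun, hqueue]
        -- The packet `q` itself may be discarded, but then one at least as fresh is kept, and `Q`
        -- is an upper set.
        obtain ⟨q', hq', hle⟩ := exists_mem_keepFreshest hB
          (S := o.waiting e \ (lgfsServer o e).toFinset) (q := q)
          (Finset.mem_sdiff.2 ⟨hq, fun hc => hsQ ⟨q, by simpa using hc, hqQ⟩⟩)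
        exact ⟨q', hq', hQ hle hqQ⟩

/-- If a link is late to send a fresh packet, then a transmission was in progress when the packet
arrived at the link. -/
theorem lgfs_busy_of_lt_served {Q : Set ℕ} (hQ : IsUpperSet Q) {e : I.Link} (hB : 1 ≤ I.buffer e)
    {d : ℝ≥0} (h : hitTime (nonPrmpLGFS I Ξ) u mode x (SeenAt (I.src e) Q) + d
      < hitTime (nonPrmpLGFS I Ξ) u mode x (ServedOn e Q)) :
    ∃ n p, SeenAt (I.src e) Q (run (nonPrmpLGFS I Ξ) u mode x n) ∧
      (∀ i < n, ¬ SeenAt (I.src e) Q (run (nonPrmpLGFS I Ξ) u mode x i)) ∧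
      (run (nonPrmpLGFS I Ξ) u mode x n).server e = some p ∧
      (run (nonPrmpLGFS I Ξ) u mode x n).time + d
        < (run (nonPrmpLGFS I Ξ) u mode x n).since e + x e p 0 := by
  obtain ⟨n, h1, h2, h3⟩ := exists_hitTime_eq (π := nonPrmpLGFS I Ξ) (u := u) (mode := mode)
    (x := x) (P := SeenAt (I.src e) Q) (fun hc => by simp [hc] at h)
  rw [h3] at h
  have hns : ∀ i ≤ n, ¬ ServedOn e Q (run (nonPrmpLGFS I Ξ) u mode x i) := fun i hi hc => by
    refine absurd (h.trans_le (hitTime_le hc)) (not_lt.2 ?_)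
    refine (ENNReal.coe_le_coe.2 (monotone_time (nonPrmpLGFS I Ξ) u mode x hi)).trans ?_
    exact le_self_add
  obtain ⟨p, hp⟩ : ∃ p, (run (nonPrmpLGFS I Ξ) u mode x n).server e = some p := by
    cases hs : (run (nonPrmpLGFS I Ξ) u mode x n).server e with
    | some p => exact ⟨p, rfl⟩
    | none =>
      -- An idle link has an empty queue, so a packet of `Q` at its origin would already have been
      -- put into service.
      have hq := (lgfs_no_preemption (I := I) (Ξ := Ξ) (u := u) (mode := mode) (x := x) n).2.2.2 e hs
      rcases lgfs_waiting hQ hB h1 with ⟨i, hi, hi'⟩ | ⟨q, hq', -⟩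
      · exact absurd hi' (hns i hi)
      · simp [hq] at hq'
  refine ⟨n, p, h1, h2, hp, ?_⟩
  suffices hle : hitTime (nonPrmpLGFS I Ξ) u mode x (ServedOn e Q)
      ≤ (((run (nonPrmpLGFS I Ξ) u mode x n).since e + x e p 0 : ℝ≥0) : ℝ≥0∞) by
    exact_mod_cast h.trans_le hle
  -- When the transmission in progress ends, either a packet of `Q` has already been sent or one is
  -- waiting. In the latter case the link takes the freshest waiting packet, which belongs to the
  -- upper set `Q`.
  obtain ⟨i, hi, T, hT, hsi, hd, hrun⟩ := lgfs_completes hp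
  have htime : (run (nonPrmpLGFS I Ξ) u mode x (i + 1)).time = T := by rw [hrun]; rfl
  have h1i : SeenAt (I.src e) Q (run (nonPrmpLGFS I Ξ) u mode x i) := by
    obtain ⟨l, hl, hlQ⟩ := h1
    exact ⟨l, monotone_seen _ _ _ _ _ hi hl, hlQ⟩
  suffices hex : ∃ j ≤ i + 1, ServedOn e Q (run (nonPrmpLGFS I Ξ) u mode x j) by
    obtain ⟨j, hj, hj'⟩ := hex
    refine (hitTime_le hj').trans (ENNReal.coe_le_coe.2 ?_)
    exact (monotone_time (nonPrmpLGFS I Ξ) u mode x hj).trans (htime.trans_le hT)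
  rcases lgfs_waiting hQ hB h1i with ⟨j, hj, hj'⟩ | ⟨q, hq, hqQ⟩
  · exact ⟨j, by omega, hj'⟩
  · refine ⟨i + 1, le_rfl, ?_⟩
    rw [hrun]
    set σ := run (nonPrmpLGFS I Ξ) u mode x i
    set o := σ.snapshot (σ.fresh T) (σ.done mode x T) with ho
    have hos : o.server e = none := if_pos hd
    have hqw : q ∈ o.waiting e := State.mem_snapshot_waiting.2 (Or.inl hq)
    obtain ⟨m, hm⟩ := Finset.max_of_mem hqw
    refine ⟨m, ?_, hQ (Finset.le_max_of_eq hqw hm) hqQ⟩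
    change lgfsServer o e = some m
    rw [lgfsServer, hos]
    exact hm

/-- The delay of a transmission is put in the same form as a wait, as the residual of a transmission
in progress at a hitting time, so that `RandomTimes.residual_le` covers both. That the transmission
starts at this very time is not needed. -/
theorem lgfs_busy_of_lt_seen {Q : Set ℕ} {e : I.Link} {d : ℝ≥0}
    (h : hitTime (nonPrmpLGFS I Ξ) u mode x (ServedOn e Q) + d
      < hitTime (nonPrmpLGFS I Ξ) u mode x (SeenAt (I.dst e) Q)) :
    ∃ n p, ServedOn e Q (run (nonPrmpLGFS I Ξ) u mode x n) ∧
      (∀ i < n, ¬ ServedOn e Q (run (nonPrmpLGFS I Ξ) u mode x i)) ∧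
      (run (nonPrmpLGFS I Ξ) u mode x n).server e = some p ∧
      (run (nonPrmpLGFS I Ξ) u mode x n).time + d
        < (run (nonPrmpLGFS I Ξ) u mode x n).since e + x e p 0 := by
  obtain ⟨n, h1, h2, h3⟩ := exists_hitTime_eq (π := nonPrmpLGFS I Ξ) (u := u) (mode := mode)
    (x := x) (P := ServedOn e Q) (fun hc => by simp [hc] at h)
  rw [h3] at h
  obtain ⟨p, hp, hpQ⟩ := h1
  refine ⟨n, p, ⟨p, hp, hpQ⟩, h2, hp, ?_⟩
  suffices hle : hitTime (nonPrmpLGFS I Ξ) u mode x (SeenAt (I.dst e) Q)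
      ≤ (((run (nonPrmpLGFS I Ξ) u mode x n).since e + x e p 0 : ℝ≥0) : ℝ≥0∞) by
    exact_mod_cast h.trans_le hle
  obtain ⟨i, hi, T, hT, hsi, hd, hrun⟩ := lgfs_completes hp
  have htime : (run (nonPrmpLGFS I Ξ) u mode x (i + 1)).time = T := by rw [hrun]; rfl
  have hseen : SeenAt (I.dst e) Q (run (nonPrmpLGFS I Ξ) u mode x (i + 1)) := by
    refine ⟨p, ?_, hpQ⟩
    rw [hrun]
    exact State.mem_seenAfter.2 (Or.inr (Or.inr ⟨e, hd, rfl, hsi⟩))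
  refine (hitTime_le hseen).trans (ENNReal.coe_le_coe.2 ?_)
  rw [htime]
  exact hT

/-- Under the non-preemptive policy, arrivals at the gateway are noticed at once. -/
theorem lgfs_hitTime_gateway_le {Q : Set ℕ} :
    hitTime (nonPrmpLGFS I Ξ) u mode x (SeenAt 0 Q) ≤ ⨅ l ∈ Q, I.arr l := by
  by_cases h : (⨅ l ∈ Q, I.arr l) = ⊤
  · rw [h]; exact le_top
  · obtain ⟨T, hT⟩ := WithTop.ne_top_iff_exists.1 h
    obtain ⟨l, hl, hlT⟩ := I.exists_arr_le hT.symm.le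
    obtain ⟨n, h1, h2⟩ := lgfs_exists_lt_nextTime (I := I) u mode x T
    rw [← hT]
    refine (hitTime_le (n := n) ⟨l, ?_, hl⟩).trans (ENNReal.coe_le_coe.2 h1)
    by_contra hc
    exact absurd ((State.nextTime_le_arr hc).trans hlT) (not_le.2 h2)

end LGFS

/-! ### Measurability of functions with discrete values. -/

section DiscreteMeasurability

variable {Z : Type*} [MeasurableSpace Z] {α β γ : Type*}

/-- All preimages of the function are measurable. -/
def DMeas (f : Z → α) : Prop := ∀ s, MeasurableSet (f ⁻¹' s)

theorem DMeas.of_countable [Countable α] {f : Z → α} (h : ∀ a, MeasurableSet {z | f z = a}) :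
    DMeas f := by
  intro s
  have : f ⁻¹' s = ⋃ a ∈ s, {z | f z = a} := by ext; simp
  rw [this]
  exact MeasurableSet.biUnion (Set.to_countable s) fun a _ => h a

theorem DMeas.comp {f : Z → α} (h : DMeas f) (g : α → β) : DMeas fun z => g (f z) :=
  fun s => h (g ⁻¹' s)

theorem DMeas.eq_const {f : Z → α} (h : DMeas f) (a : α) : MeasurableSet {z | f z = a} := h {a}

theorem DMeas.pred {p : Z → Prop} (h : DMeas p) : MeasurableSet {z | p z} := by
  simpa using h.eq_const True

theorem DMeas.of_pred {p : Z → Prop} (h : MeasurableSet {z | p z}) : DMeas p := by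
  refine DMeas.of_countable fun a => ?_
  by_cases ha : a
  · simpa [ha] using h
  · convert h.compl using 1
    ext z
    simp [ha]

/-- Splitting over the countably many values of `d` freezes the discrete data. The measurability
fields of `Policy` are stated for frozen data only. -/
theorem DMeas.bind [Countable α] {d : Z → α} (hd : DMeas d) {F : α → Z → β}
    (hF : ∀ a, DMeas (F a)) : DMeas fun z => F (d z) z := by
  intro s
  have : (fun z => F (d z) z) ⁻¹' s = ⋃ a, {z | d z = a} ∩ F a ⁻¹' s := by ext; simp
  rw [this]
  exact MeasurableSet.iUnion fun a => (hd.eq_const a).inter (hF a s)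

theorem DMeas.measurable_bind [Countable α] [MeasurableSpace β] {d : Z → α} (hd : DMeas d)
    {F : α → Z → β} (hF : ∀ a, Measurable (F a)) : Measurable fun z => F (d z) z := by
  intro s hs
  have : (fun z => F (d z) z) ⁻¹' s = ⋃ a, {z | d z = a} ∩ F a ⁻¹' s := by ext; simp
  rw [this]
  exact MeasurableSet.iUnion fun a => (hd.eq_const a).inter (hF a hs)

theorem DMeas.prodMk [Countable α] {f : Z → α} {g : Z → β} (hf : DMeas f)
    (hg : DMeas g) : DMeas fun z => (f z, g z) :=
  hf.bind (F := fun a z => (a, g z)) fun a => hg.comp fun b => (a, b)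

theorem DMeas.pi {ι : Type*} [Finite ι] [Countable α] {f : Z → ι → α}
    (hf : ∀ i, DMeas fun z => f z i) : DMeas f := by
  refine DMeas.of_countable fun a => ?_
  have : {z | f z = a} = ⋂ i, {z | f z i = a i} := by ext; simp [funext_iff]
  rw [this]
  exact MeasurableSet.iInter fun i => (hf i).eq_const _

theorem DMeas.finset {ι : Type*} [Countable ι] {f : Z → Finset ι}
    (hf : ∀ i, MeasurableSet {z | i ∈ f z}) : DMeas f := by
  refine DMeas.of_countable fun a => ?_
  have : {z | f z = a} = ⋂ i, {z | i ∈ f z ↔ i ∈ a} := by ext; simp [Finset.ext_iff]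
  rw [this]
  refine MeasurableSet.iInter fun i => ?_
  by_cases hi : i ∈ a
  · simpa [hi] using hf i
  · convert (hf i).compl using 1
    ext z
    simp [hi]

instance {L : Type} [Finite L] : Countable (Snapshot L) :=
  Function.Injective.countable (f := fun o : Snapshot L => (o.server, o.waiting)) <| by
    rintro ⟨a, b⟩ ⟨c, d⟩ h
    simpa using h

end DiscreteMeasurability

/-! ### Measurability of the state at each epoch and of hitting times. -/

section RunMeasurability

variable {N : ℕ} {I : Network N} {Ξ : Type*} [MeasurableSpace Ξ]
  {Z : Type*} [MeasurableSpace Z]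

/-- A random state of which all components are measurable. -/
structure MeasState (σ : Z → State I) : Prop where
  time : Measurable fun z => (σ z).time
  seen : ∀ j, DMeas fun z => (σ z).seen j
  queue : ∀ e, DMeas fun z => (σ z).queue e
  server : ∀ e, DMeas fun z => (σ z).server e
  since : ∀ e, Measurable fun z => (σ z).since e
  served : ∀ e p, Measurable fun z => (σ z).served e p
  tries : ∀ e p, DMeas fun z => (σ z).tries e p
  alarm : Measurable fun z => (σ z).alarm
  history_data : DMeas fun z => (σ z).history.map Prod.snd
  history_time : ∀ i, Measurable fun z => ((σ z).history.map Prod.fst).getD i 0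

theorem DMeas.const {α : Type*} (a : α) : DMeas fun _ : Z => a := fun _ => MeasurableSet.const _

theorem MeasState.const (σ : State I) : MeasState fun _ : Z => σ where
  time := measurable_const
  seen _ := DMeas.const _
  queue _ := DMeas.const _
  server _ := DMeas.const _
  since _ := measurable_const
  served _ _ := measurable_const
  tries _ _ := DMeas.const _
  alarm := measurable_const
  history_data := DMeas.const _
  history_time _ := measurable_const

theorem MeasState.ite {p : Z → Prop} [DecidablePred p] (hp : MeasurableSet {z | p z}) {σ τ : Z → State I}
    (h : MeasState σ) (h' : MeasState τ) : MeasState fun z => if p z then σ z else τ z := by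
  classical
  have hd : ∀ {α : Type} (f : State I → α), (DMeas fun z => f (σ z)) → (DMeas fun z => f (τ z)) →
      DMeas fun z => f (if p z then σ z else τ z) := by
    intro α f h1 h2
    simp only [apply_ite f]
    convert DMeas.bind (DMeas.of_pred hp) (F := fun a z => if a then f (σ z) else f (τ z))
      fun a => by by_cases ha : a <;> simpa [ha]
  have hm : ∀ {α : Type} [MeasurableSpace α] (f : State I → α), (Measurable fun z => f (σ z)) →
      (Measurable fun z => f (τ z)) → Measurable fun z => f (if p z then σ z else τ z) := by
    intro α _ f h1 h2
    simp only [apply_ite f]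
    exact Measurable.ite hp h1 h2
  exact
  { time := hm (fun s => s.time) h.time h'.time
    seen := fun j => hd (fun s => s.seen j) (h.seen j) (h'.seen j)
    queue := fun e => hd (fun s => s.queue e) (h.queue e) (h'.queue e)
    server := fun e => hd (fun s => s.server e) (h.server e) (h'.server e)
    since := fun e => hm (fun s => s.since e) (h.since e) (h'.since e)
    served := fun e q => hm (fun s => s.served e q) (h.served e q) (h'.served e q)
    tries := fun e q => hd (fun s => s.tries e q) (h.tries e q) (h'.tries e q)
    alarm := hm (fun s => s.alarm) h.alarm h'.alarm
    history_data := hd (fun s => s.history.map Prod.snd) h.history_data h'.history_data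
    history_time := fun i =>
      hm (fun s => (s.history.map Prod.fst).getD i 0) (h.history_time i) (h'.history_time i) }

variable {σ : Z → State I} {x : Z → I.Link → ℕ → ℕ → ℝ≥0}

theorem MeasState.completion (h : MeasState σ) (mode : Preemption)
    (hx : ∀ e l n, Measurable fun z => x z e l n) (e : I.Link) :
    Measurable fun z => (σ z).completion mode (x z) e := by
  let F : Option ℕ → Z → ℝ≥0∞ := fun a z => match a with
      | none => (⊤ : ℝ≥0∞)
      | some p => match mode with
        | .resume => (((σ z).since e + (x z e p 0 - (σ z).served e p) : ℝ≥0) : ℝ≥0∞)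
        | .restart => (((σ z).since e + x z e p 0 : ℝ≥0) : ℝ≥0∞)
        | .redraw => (((σ z).since e + x z e p ((σ z).tries e p) : ℝ≥0) : ℝ≥0∞)
  have h1 : Measurable fun z => F ((σ z).server e) z := by
    refine DMeas.measurable_bind (h.server e) fun a => ?_
    cases a with
    | none => exact measurable_const
    | some p =>
      cases mode with
      | resume => exact ((h.since e).add ((hx e p 0).sub (h.served e p))).coe_nnreal_ennreal
      | restart => exact ((h.since e).add (hx e p 0)).coe_nnreal_ennreal
      | redraw =>
        have h2 : Measurable fun z => x z e p ((σ z).tries e p) :=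
          (h.tries e p).measurable_bind (F := fun k z => x z e p k) fun k => hx e p k
        exact ((h.since e).add h2).coe_nnreal_ennreal
  exact h1

variable [NeZero N]

theorem MeasState.nextTime (h : MeasState σ) (mode : Preemption)
    (hx : ∀ e l n, Measurable fun z => x z e l n) :
    Measurable fun z => (σ z).nextTime mode (x z) := by
  refine Measurable.min ?_ (Measurable.min ?_ h.alarm)
  · exact (h.seen 0).measurable_bind (F := fun S _ => ⨅ l ∈ {l : ℕ | l ∉ S}, I.arr l)
      fun S => measurable_const
  · exact Measurable.iInf fun e => h.completion mode hx e

theorem MeasState.dMeas_fresh (h : MeasState σ) {T : Z → ℝ≥0} (hT : Measurable T) :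
    DMeas fun z => (σ z).fresh (T z) := by
  have h1 : DMeas fun z => I.arrivedBy (T z) := by
    refine DMeas.finset fun l => ?_
    simp only [I.mem_arrivedBy]
    exact measurableSet_le measurable_const hT.coe_nnreal_ennreal
  exact (h1.prodMk (h.seen 0)).comp fun a => a.1 \ a.2

omit [NeZero N] in
theorem MeasState.dMeas_done (h : MeasState σ) (mode : Preemption)
    (hx : ∀ e l n, Measurable fun z => x z e l n) {T : Z → ℝ≥0} (hT : Measurable T) :
    DMeas fun z => (σ z).done mode (x z) (T z) := by
  refine DMeas.finset fun e => ?_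
  simp only [State.mem_done]
  exact measurableSet_le (h.completion mode hx e) hT.coe_nnreal_ennreal

theorem MeasState.dMeas_seenAfter (h : MeasState σ) {A : Z → Finset ℕ} {D : Z → Finset I.Link}
    (hA : DMeas A) (hD : DMeas D) (j : Fin N) :
    DMeas fun z => (σ z).seenAfter (A z) (D z) j := by
  have h1 := (DMeas.pi h.server).prodMk ((h.seen j).prodMk (hA.prodMk hD))
  -- Only `server` and `seen j` are read, so the other fields, and `seen` at the other nodes, may be
  -- filled arbitrarily.
  exact h1.comp fun a =>
    ({ State.empty I with server := a.1, seen := fun _ => a.2.1 } : State I).seenAfter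
      a.2.2.1 a.2.2.2 j

theorem MeasState.dMeas_snapshot (h : MeasState σ) {A : Z → Finset ℕ} {D : Z → Finset I.Link}
    (hA : DMeas A) (hD : DMeas D) :
    DMeas fun z => (σ z).snapshot (A z) (D z) := by
  have h1 := (DMeas.pi h.server).prodMk ((DMeas.pi h.queue).prodMk ((DMeas.pi h.seen).prodMk
    (hA.prodMk hD)))
  exact h1.comp fun a =>
    ({ State.empty I with server := a.1, queue := a.2.1, seen := a.2.2.1 } : State I).snapshot
      a.2.2.2.1 a.2.2.2.2

-- This is the form in which `Policy` states measurability: fixed length and discrete data, with a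
-- vector of real times. The default 0 of `getD` is never reached, since the index is below the
-- length.
omit [NeZero N] in
theorem history_eq_ofFn {L : Type} {h : History L} {d : List (Finset ℕ × Finset L)}
    (hd : h.map Prod.snd = d) :
    h = List.ofFn fun i : Fin d.length => ((h.map Prod.fst).getD i 0, d.get i) := by
  subst hd
  apply List.ext_getElem
  · simp
  · intro i h1 h2
    have h3 : i < (h.map Prod.fst).length := by simpa using h1
    rw [List.getElem_ofFn, List.getD_eq_getElem _ _ h3]
    simp

omit [NeZero N] [MeasurableSpace Z] in
theorem decide_eq_ofFn (π : Policy I Ξ) {h : Z → History I.Link} {o : Z → Snapshot I.Link}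
    (u : Z → Ξ) (z : Z) :
    π.decide (u z) (h z) (o z) = π.decide (u z)
      (List.ofFn fun i : Fin ((h z).map Prod.snd).length =>
        (((h z).map Prod.fst).getD i 0, ((h z).map Prod.snd).get i)) (o z) := by
  rw [← history_eq_ofFn rfl]

omit [NeZero N] in
theorem dMeas_decide_server (π : Policy I Ξ) {u : Z → Ξ} (hu : Measurable u)
    {h : Z → History I.Link} {o : Z → Snapshot I.Link} (ho : DMeas o)
    (h1 : DMeas fun z => (h z).map Prod.snd)
    (h2 : ∀ i, Measurable fun z => ((h z).map Prod.fst).getD i 0) (e : I.Link) :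
    DMeas fun z => (π.decide (u z) (h z) (o z)).server e := by
  simp only [decide_eq_ofFn π u]
  refine (h1.prodMk ho).bind (F := fun a z => (π.decide (u z)
    (List.ofFn fun i : Fin a.1.length => (((h z).map Prod.fst).getD i 0, a.1.get i)) a.2).server e)
    fun a => DMeas.of_countable fun p => ?_
  exact (hu.prodMk (measurable_pi_lambda _ fun i : Fin a.1.length => h2 i))
    (π.measurable_server a.1.length a.1.get a.2 e p)

omit [NeZero N] in
theorem dMeas_decide_queue (π : Policy I Ξ) {u : Z → Ξ} (hu : Measurable u)
    {h : Z → History I.Link} {o : Z → Snapshot I.Link} (ho : DMeas o)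
    (h1 : DMeas fun z => (h z).map Prod.snd)
    (h2 : ∀ i, Measurable fun z => ((h z).map Prod.fst).getD i 0) (e : I.Link) :
    DMeas fun z => (π.decide (u z) (h z) (o z)).queue e := by
  simp only [decide_eq_ofFn π u]
  refine (h1.prodMk ho).bind (F := fun a z => (π.decide (u z)
    (List.ofFn fun i : Fin a.1.length => (((h z).map Prod.fst).getD i 0, a.1.get i)) a.2).queue e)
    fun a => DMeas.of_countable fun p => ?_
  exact (hu.prodMk (measurable_pi_lambda _ fun i : Fin a.1.length => h2 i))
    (π.measurable_queue a.1.length a.1.get a.2 e p)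

omit [NeZero N] in
theorem measurable_decide_wait (π : Policy I Ξ) {u : Z → Ξ} (hu : Measurable u)
    {h : Z → History I.Link} {o : Z → Snapshot I.Link} (ho : DMeas o)
    (h1 : DMeas fun z => (h z).map Prod.snd)
    (h2 : ∀ i, Measurable fun z => ((h z).map Prod.fst).getD i 0) :
    Measurable fun z => (π.decide (u z) (h z) (o z)).wait := by
  simp only [decide_eq_ofFn π u]
  refine (h1.prodMk ho).measurable_bind (F := fun a z => (π.decide (u z)
    (List.ofFn fun i : Fin a.1.length => (((h z).map Prod.fst).getD i 0, a.1.get i)) a.2).wait)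
    fun a => ?_
  exact (π.measurable_wait a.1.length a.1.get a.2).comp
    (hu.prodMk (measurable_pi_lambda _ fun i : Fin a.1.length => h2 i))

theorem MeasState.advance (h : MeasState σ) (π : Policy I Ξ) {u : Z → Ξ} (hu : Measurable u)
    (mode : Preemption) (hx : ∀ e l n, Measurable fun z => x z e l n)
    {T : Z → ℝ≥0} (hT : Measurable T) :
    MeasState fun z => (σ z).advance π (u z) mode (x z) (T z) := by
  classical
  have hA := h.dMeas_fresh hT
  have hD := h.dMeas_done mode hx hT
  have ho := h.dMeas_snapshot hA hD
  have hh1 : DMeas fun z => (((T z, (σ z).fresh (T z), (σ z).done mode (x z) (T z)) ::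
      (σ z).history : History I.Link).map Prod.snd) :=
    (hA.prodMk (hD.prodMk h.history_data)).comp fun a => (a.1, a.2.1) :: a.2.2
  have hh2 : ∀ i, Measurable fun z => (((T z, (σ z).fresh (T z), (σ z).done mode (x z) (T z)) ::
      (σ z).history : History I.Link).map Prod.fst).getD i 0 := by
    intro i
    cases i with
    | zero => exact hT
    | succ i => exact h.history_time i
  have hs := dMeas_decide_server π hu ho hh1 hh2
  have hpre : ∀ e p, MeasurableSet {z | preempts ((σ z).snapshot ((σ z).fresh (T z))
      ((σ z).done mode (x z) (T z))) (π.decide (u z) ((T z, (σ z).fresh (T z),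
        (σ z).done mode (x z) (T z)) :: (σ z).history) ((σ z).snapshot ((σ z).fresh (T z))
      ((σ z).done mode (x z) (T z)))) e p} := fun e p =>
    ((ho.prodMk (hs e)).comp fun a => a.1.server e = some p ∧ a.2 ≠ some p).pred
  exact
  { time := hT
    seen := fun j => h.dMeas_seenAfter hA hD j
    queue := dMeas_decide_queue π hu ho hh1 hh2
    server := hs
    since := fun e => Measurable.ite
      (((ho.prodMk (hs e)).comp fun a => a.1.server e = a.2).pred) (h.since e) hT
    served := fun e p => Measurable.ite (hpre e p)
      ((h.served e p).add (hT.sub (h.since e))) (h.served e p)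
    tries := fun e p => ((DMeas.of_pred (hpre e p)).prodMk (h.tries e p)).comp
      fun a => if a.1 then a.2 + 1 else a.2
    alarm := hT.coe_nnreal_ennreal.add (measurable_decide_wait π hu ho hh1 hh2)
    history_data := hh1
    history_time := hh2 }

theorem measState_run (π : Policy I Ξ) {u : Z → Ξ} (hu : Measurable u)
    (mode : Preemption) (hx : ∀ e l n, Measurable fun z => x z e l n) (n : ℕ) :
    MeasState fun z => run π (u z) mode (x z) n := by
  induction n with
  | zero => exact MeasState.const _
  | succ n ih =>
    simp only [run_succ, State.step]
    exact MeasState.ite (p := fun z => (run π (u z) mode (x z) n).nextTime mode (x z) = ⊤)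
      ((ih.nextTime mode hx) (measurableSet_singleton ⊤)) ih
      (ih.advance π hu mode hx (ih.nextTime mode hx).ennreal_toNNReal)

omit [NeZero N] in
theorem MeasState.measurableSet_seenAt (h : MeasState σ) (j : Fin N) (Q : Set ℕ) :
    MeasurableSet {z | SeenAt j Q (σ z)} :=
  ((h.seen j).comp fun S => ∃ l ∈ S, l ∈ Q).pred

omit [NeZero N] in
theorem MeasState.measurableSet_servedOn (h : MeasState σ) (e : I.Link) (Q : Set ℕ) :
    MeasurableSet {z | ServedOn e Q (σ z)} :=
  ((h.server e).comp fun s => ∃ l, s = some l ∧ l ∈ Q).pred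

open Classical in
/-- Hitting times are measurable, jointly in a parameter of the property. -/
theorem measurable_hitTime (π : Policy I Ξ) {u : Z → Ξ} (hu : Measurable u)
    (mode : Preemption) (hx : ∀ e l n, Measurable fun z => x z e l n) {P : Z → State I → Prop}
    (hP : ∀ n, MeasurableSet {z | P z (run π (u z) mode (x z) n)}) :
    Measurable fun z => hitTime π (u z) mode (x z) (P z) := by
  refine Measurable.iInf fun n => ?_
  simp only [iInf_eq_if]
  exact Measurable.ite (hP n) (measState_run π hu mode hx n).time.coe_nnreal_ennreal
    measurable_const

end RunMeasurability

/-! ### Pathwise lower bound on delivery over a link, for any policy. -/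

section ForcedDelay

variable {N : ℕ} {I : Network N} {Ξ : Type*} [MeasurableSpace Ξ]
  {mode : Preemption} {x y : I.Link → ℕ → ℕ → ℝ≥0} {σ : State I} {e : I.Link} {Q : Set ℕ}

/-- Index of the transmission time that governs the transmission of packet `l` over link `e`. -/
def State.attempt (σ : State I) (mode : Preemption) (e : I.Link) (l : ℕ) : ℕ :=
  match mode with
  | .resume => 0
  | .restart => 0
  | .redraw => σ.tries e l

/-- Earlier work that counts for the transmission of packet `l` over link `e`. -/
def State.offset (σ : State I) (mode : Preemption) (e : I.Link) (l : ℕ) : ℝ≥0 :=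
  match mode with
  | .resume => σ.served e l
  | .restart => 0
  | .redraw => 0

/-- One formula for the three conventions on preemption, so that the lower bound is proved only
once. -/
theorem State.completion_eq {l : ℕ} (h : σ.server e = some l) :
    σ.completion mode x e = ((σ.since e + (x e l (σ.attempt mode e l) - σ.offset mode e l) : ℝ≥0) :
      ℝ≥0∞) := by
  cases mode <;> simp [State.completion, h, State.attempt, State.offset]

/-- `w` bounds the work of link `e` on each transmission time of the packets of `Q`; none of these
packets has passed the link, and the link has not worked on them before time `a`. -/
structure Pending (e : I.Link) (Q : Set ℕ) (mode : Preemption) (a : ℝ≥0) (σ : State I)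
    (w : ℕ × ℕ →₀ ℝ≥0) : Prop where
  sum_le : (w.sum fun _ v => v) ≤ σ.time - a
  not_seen : ¬ SeenAt (I.dst e) Q σ
  served_le : mode = .resume → ∀ l ∈ Q, σ.served e l ≤ w (l, 0)
  spent_le : ∀ l ∈ Q, σ.server e = some l →
    σ.offset mode e l + (σ.time - σ.since e) ≤ w (l, σ.attempt mode e l)

/-- The transmission times `y` agree with `x`, except that those of the packets of `Q` over link `e`
exceed `w`. -/
def Exceeds (e : I.Link) (Q : Set ℕ) (x : I.Link → ℕ → ℕ → ℝ≥0) (w : ℕ × ℕ →₀ ℝ≥0)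
    (y : I.Link → ℕ → ℕ → ℝ≥0) : Prop :=
  (∀ f l n, ¬ (f = e ∧ l ∈ Q) → y f l n = x f l n) ∧ ∀ l n, l ∈ Q → w (l, n) < y e l n

theorem Exceeds.mono {w w' : ℕ × ℕ →₀ ℝ≥0} (hw : ∀ i, w i ≤ w' i) (h : Exceeds e Q x w' y) :
    Exceeds e Q x w y :=
  ⟨h.1, fun l n hl => (hw _).trans_lt (h.2 l n hl)⟩

theorem exists_exceeds (e : I.Link) (Q : Set ℕ) (x : I.Link → ℕ → ℕ → ℝ≥0)
    (w : ℕ × ℕ →₀ ℝ≥0) : ∃ y, Exceeds e Q x w y := by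
  classical
  refine ⟨fun f l n => if f = e ∧ l ∈ Q then w (l, n) + 1 else x f l n, fun f l n h => if_neg h,
    fun l n hl => ?_⟩
  simp [hl]

theorem Exceeds.completion_eq_of_ne {y' : I.Link → ℕ → ℕ → ℝ≥0} {w w' : ℕ × ℕ →₀ ℝ≥0}
    (h : Exceeds e Q x w y) (h' : Exceeds e Q x w' y') (f : I.Link)
    (hf : ∀ l ∈ Q, σ.server f = some l → f ≠ e) :
    σ.completion mode y f = σ.completion mode y' f := by
  cases hs : σ.server f with
  | none => simp [State.completion, hs]
  | some l =>
    have : ¬ (f = e ∧ l ∈ Q) := fun hc => hf l hc.2 hs hc.1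
    rw [State.completion_eq hs, State.completion_eq hs, h.1 f l _ this, h'.1 f l _ this]

/-- The work that counts so far is at most the share booked in `w`, so a transmission time above the
share plus `d` has more than `d` left. -/
theorem Pending.lt_completion {a : ℝ≥0} {w : ℕ × ℕ →₀ ℝ≥0} (h : Pending e Q mode a σ w)
    (hs : σ.since e ≤ σ.time) {l : ℕ} (hl : l ∈ Q) (hsl : σ.server e = some l) {d : ℝ≥0}
    (hd : w (l, σ.attempt mode e l) + d < y e l (σ.attempt mode e l)) :
    ((σ.time + d : ℝ≥0) : ℝ≥0∞) < σ.completion mode y e := by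
  rw [State.completion_eq hsl, ENNReal.coe_lt_coe]
  have h1 : σ.offset mode e l + (σ.time - σ.since e) + d < y e l (σ.attempt mode e l) :=
    lt_of_le_of_lt (by gcongr; exact h.spent_le l hl hsl) hd
  have h2 : (σ.time - σ.since e) + d < y e l (σ.attempt mode e l) - σ.offset mode e l := by
    rw [lt_tsub_iff_left]
    rwa [← add_assoc]
  calc σ.time + d = σ.since e + ((σ.time - σ.since e) + d) := by
        rw [← add_assoc, add_tsub_cancel_of_le hs]
    _ < _ := by gcongr

variable [NeZero N]

/-- The time elapsed since the previous epoch is booked on the attempt in progress. A newly started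
attempt has no elapsed time; earlier work carries over to it only under `resume`, through `served`.
Packets of `Q` can enter the destination over `e` alone. -/
theorem Pending.advance (hin : I.SingleIn) (he : I.dst e ≠ 0) {a : ℝ≥0} {w w' : ℕ × ℕ →₀ ℝ≥0}
    (h : Pending e Q mode a σ w) (hv : σ.Valid mode y) (π : Policy I Ξ) (u : Ξ) {T : ℝ≥0}
    (hT : σ.nextTime mode y = T) (hd : ∀ l ∈ Q, σ.server e = some l → e ∉ σ.done mode y T)
    (hw : ∀ i, w i ≤ w' i) (hw' : ∀ l ∈ Q, σ.server e = some l →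
      w (l, σ.attempt mode e l) + (T - σ.time) ≤ w' (l, σ.attempt mode e l))
    (hsum : (w'.sum fun _ v => v) ≤ T - a) :
    Pending e Q mode a (σ.advance π u mode y T) w' := by
  have hle : σ.time ≤ T := by exact_mod_cast hT ▸ hv.le_nextTime
  set o := σ.snapshot (σ.fresh T) (σ.done mode y T) with ho
  set b := π.decide u ((T, σ.fresh T, σ.done mode y T) :: σ.history) o with hb
  have hsplit : T - σ.since e = (σ.time - σ.since e) + (T - σ.time) := by
    rw [add_comm]
    exact (tsub_add_tsub_cancel hle (hv.since_le e)).symm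
  have hspent : ∀ l ∈ Q, o.server e = some l →
      σ.offset mode e l + (T - σ.since e) ≤ w' (l, σ.attempt mode e l) := by
    intro l hl hol
    have hsl := (State.snapshot_server_eq_some.1 hol).2
    rw [hsplit, ← add_assoc]
    exact (add_le_add_left (h.spent_le l hl hsl) _).trans (hw' l hl hsl)
  have hserved : mode = .resume → ∀ l ∈ Q, (σ.advance π u mode y T).served e l ≤ w' (l, 0) := by
    intro hm l hl
    by_cases hp : preempts o b e l
    · have h1 : (σ.advance π u mode y T).served e l = σ.served e l + (T - σ.since e) := if_pos hp
      rw [h1]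
      have := hspent l hl hp.1
      subst hm
      exact this
    · have h1 : (σ.advance π u mode y T).served e l = σ.served e l := if_neg hp
      rw [h1]
      exact (h.served_le hm l hl).trans (hw _)
  refine ⟨hsum, ?_, hserved, ?_⟩
  · rintro ⟨l, hl, hlQ⟩
    rcases State.mem_seenAfter.1 hl with hl | hl | ⟨f, hf, hfe, hfl⟩
    · exact h.not_seen ⟨l, hl, hlQ⟩
    · exact he hl.1
    · have : f = e := (hin _ he).unique hfe rfl
      subst this
      exact hd l hlQ hfl hf
  · intro l hl hsl
    have htime : (σ.advance π u mode y T).time = T := rfl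
    have hbl : b.server e = some l := hsl
    rw [htime]
    by_cases hol : o.server e = some l
    · have hnp : ¬ preempts o b e l := fun hc => hc.2 hbl
      have h1 : (σ.advance π u mode y T).since e = σ.since e := if_pos (hol.trans hbl.symm)
      have h2 : (σ.advance π u mode y T).served e l = σ.served e l := if_neg hnp
      have h3 : (σ.advance π u mode y T).tries e l = σ.tries e l := if_neg hnp
      have h4 : (σ.advance π u mode y T).offset mode e l = σ.offset mode e l := by
        cases mode <;> simp [State.offset, h2]
      have h5 : (σ.advance π u mode y T).attempt mode e l = σ.attempt mode e l := by
        cases mode <;> simp [State.attempt, h3]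
      rw [h1, h4, h5]
      exact hspent l hl hol
    · have h1 : (σ.advance π u mode y T).since e = T := if_neg fun hc => hol (hc.trans hbl)
      rw [h1, tsub_self, add_zero]
      cases mode with
      | resume => exact hserved rfl l hl
      | restart => exact zero_le
      | redraw => exact zero_le

/-- Nothing arrives between epochs, and the run is constant once no epoch remains. -/
theorem lt_hitTime_of_lt_nextTime {π : Policy I Ξ} {u : Ξ} {n : ℕ} {j : Fin N} {t : ℝ≥0}
    (h : ¬ SeenAt j Q (run π u mode x n)) (ht : (t : ℝ≥0∞) < (run π u mode x n).nextTime mode x) :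
    (t : ℝ≥0∞) < hitTime π u mode x (SeenAt j Q) := by
  by_contra! hc
  obtain ⟨m, ⟨l, hl, hlQ⟩, hmt⟩ := hitTime_le_iff.1 hc
  have hnm : n < m := by
    by_contra! hmn
    exact h ⟨l, monotone_seen π u mode x j hmn hl, hlQ⟩
  by_cases hT : (run π u mode x n).nextTime mode x = ⊤
  · have hstuck : ∀ i ≥ n, run π u mode x i = run π u mode x n := by
      intro i hi
      induction i, hi using Nat.le_induction with
      | base => rfl
      | succ i hi ih => rw [run_succ, ih, State.step_eq_of_top hT]
    rw [hstuck m hnm.le] at hl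
    exact h ⟨l, hl, hlQ⟩
  · obtain ⟨T, hT⟩ := WithTop.ne_top_iff_exists.1 hT
    have h1 : (run π u mode x (n + 1)).time = T := by
      rw [run_succ, State.step_eq_advance hT.symm]; rfl
    have h2 : (run π u mode x (n + 1)).time ≤ (run π u mode x m).time :=
      monotone_time π u mode x hnm
    rw [← hT] at ht
    have h3 : t < T := ENNReal.coe_lt_coe.1 ht
    exact absurd (h3.trans_le (h1.symm.le.trans (h2.trans hmt))) (lt_irrefl _)

/-- Up to each epoch, a total amount of work on the packets of `Q` that is bounded by the time
available decides whether one of them passes link `e`: if all transmission times exceed their share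
of the work, none of the packets passes. -/
theorem exists_exceeds_forced (hin : I.SingleIn) (he : I.dst e ≠ 0) (π : Policy I Ξ) (u : Ξ)
    (x : I.Link → ℕ → ℕ → ℝ≥0) {a t : ℝ≥0} (ha : ∀ l ∈ Q, (a : ℝ≥0∞) ≤ I.arr l) (n : ℕ) :
    (∃ w σ, (∀ y, Exceeds e Q x w y → run π u mode y n = σ) ∧ σ.time ≤ t ∧
      Pending e Q mode a σ w) ∨
    ∃ w : ℕ × ℕ →₀ ℝ≥0, (w.sum fun _ v => v) ≤ t - a ∧ ∀ y, Exceeds e Q x w y →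
      (t : ℝ≥0∞) < hitTime π u mode y (SeenAt (I.dst e) Q) := by
  induction n with
  | zero =>
    refine Or.inl ⟨0, State.empty I, fun y _ => rfl, zero_le, ?_, ?_, ?_, ?_⟩
    · simp
    · simp [SeenAt, State.empty]
    · simp [State.empty]
    · simp [State.empty]
  | succ n ih =>
    rcases ih with ⟨w, σ, hrun, htime, hp⟩ | ih
    swap
    · exact Or.inr ih
    have hvalid : ∀ y, Exceeds e Q x w y → σ.Valid mode y := fun y hy =>
      hrun y hy ▸ valid_run π u mode y n
    by_cases hs : ∃ l ∈ Q, σ.server e = some l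
    · obtain ⟨l, hl, hsl⟩ := hs
      obtain ⟨y₀, hy₀⟩ := exists_exceeds e Q x w
      have hv₀ := hvalid y₀ hy₀
      -- A packet of `Q` in transmission has arrived, so time `a` has passed. This makes the
      -- truncated subtractions of `a` exact.
      have hat : a ≤ σ.time := by
        exact_mod_cast (ha l hl).trans (hv₀.arr_le _ l (hv₀.server_seen e l hsl))
      have hext : ∀ d : ℝ≥0, ∃ w' : ℕ × ℕ →₀ ℝ≥0, (∀ i, w i ≤ w' i) ∧
          w' (l, σ.attempt mode e l) = w (l, σ.attempt mode e l) + d ∧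
          (w'.sum fun _ v => v) ≤ (σ.time - a) + d := by
        intro d
        refine ⟨w + Finsupp.single (l, σ.attempt mode e l) d, fun i => le_self_add, by simp, ?_⟩
        rw [Finsupp.sum_add_index' (fun _ => rfl) (fun _ _ _ => rfl), Finsupp.sum_single_index rfl]
        gcongr
        exact hp.sum_le
      have hcong : ∀ y, Exceeds e Q x w y → ∀ y', Exceeds e Q x w y' → ∀ f, f ≠ e →
          σ.completion mode y f = σ.completion mode y' f := fun y hy y' hy' f hf =>
        hy.completion_eq_of_ne hy' f fun _ _ _ => hf
      have hoff : ∀ y, Exceeds e Q x w y →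
          σ.nextTimeOff mode y e = σ.nextTimeOff mode y₀ e := fun y hy =>
        State.nextTimeOff_congr (hcong y hy y₀ hy₀)
      -- All events other than the end of the transmission over `e` come at the same time for every
      -- admissible `y`. The work up to the next of them, or up to `t` if that is earlier, is added
      -- to the share of the current attempt; this pushes the end of the transmission strictly
      -- beyond that time.
      by_cases hτ : (t : ℝ≥0∞) < σ.nextTimeOff mode y₀ e
      · right
        obtain ⟨w', hw1, hw2, hw3⟩ := hext (t - σ.time)
        refine ⟨w', ?_, fun y hy => ?_⟩
        · rwa [add_comm, tsub_add_tsub_cancel htime hat] at hw3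
        · have hy' := hy.mono hw1
          refine lt_hitTime_of_lt_nextTime (n := n) ?_ ?_
          · rw [hrun y hy']; exact hp.not_seen
          · rw [hrun y hy', State.nextTime_eq_min σ mode y e, hoff y hy']
            refine lt_min hτ ?_
            have := hp.lt_completion (y := y) (hv₀.since_le e) hl hsl (d := t - σ.time)
              (by rw [← hw2]; exact hy.2 l _ hl)
            rwa [add_tsub_cancel_of_le htime] at this
      · left
        rw [not_lt] at hτ
        obtain ⟨T, hT⟩ := WithTop.ne_top_iff_exists.1 (ne_top_of_le_ne_top ENNReal.coe_ne_top hτ)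
        have hTt : T ≤ t := by rw [← hT] at hτ; exact ENNReal.coe_le_coe.1 hτ
        have hle : σ.time ≤ T := by
          have := hv₀.le_nextTime.trans
            ((State.nextTime_eq_min σ mode y₀ e).trans_le (min_le_left _ _))
          rw [← hT] at this
          exact ENNReal.coe_le_coe.1 this
        obtain ⟨w', hw1, hw2, hw3⟩ := hext (T - σ.time)
        have hcompl : ∀ y, Exceeds e Q x w' y → (T : ℝ≥0∞) < σ.completion mode y e := by
          intro y hy
          have := hp.lt_completion (y := y) (hv₀.since_le e) hl hsl (d := T - σ.time)
            (by rw [← hw2]; exact hy.2 l _ hl)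
          rwa [add_tsub_cancel_of_le hle] at this
        have hnext : ∀ y, Exceeds e Q x w' y → σ.nextTime mode y = T := by
          intro y hy
          rw [State.nextTime_eq_min σ mode y e, hoff y (hy.mono hw1), ← hT]
          exact min_eq_left (hcompl y hy).le
        obtain ⟨y₁, hy₁⟩ := exists_exceeds e Q x w'
        refine ⟨w', σ.advance π u mode y₁ T, fun y hy => ?_, hTt, ?_⟩
        · rw [run_succ, hrun y (hy.mono hw1), ← State.step_eq_advance (hnext y₁ hy₁)]
          refine (State.step_congr π u e (hcong y (hy.mono hw1) y₁ (hy₁.mono hw1)) (Or.inr ?_)).1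
          rw [hnext y hy]
          exact ⟨hcompl y hy, hcompl y₁ hy₁⟩
        · refine hp.advance hin he (hvalid y₁ (hy₁.mono hw1)) π u (hnext y₁ hy₁) ?_ hw1 ?_ ?_
          · intro _ _ _ hc
            exact absurd (State.mem_done.1 hc) (not_le.2 (hcompl y₁ hy₁))
          · intro l' _ hl'
            have : l' = l := by rw [hsl] at hl'; exact (Option.some.inj hl').symm
            rw [this, hw2]
          · rwa [add_comm, tsub_add_tsub_cancel hle hat] at hw3
    -- Link `e` is not working on `Q`, so no undetermined transmission time is in play and `w` stays
    -- unchanged.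
    · have hcong : ∀ y, Exceeds e Q x w y → ∀ y', Exceeds e Q x w y' → ∀ f,
          σ.completion mode y f = σ.completion mode y' f := fun y hy y' hy' f =>
        hy.completion_eq_of_ne hy' f fun l hl hfl hfe => hs ⟨l, hl, hfe ▸ hfl⟩
      obtain ⟨y₀, hy₀⟩ := exists_exceeds e Q x w
      have hstep : ∀ y, Exceeds e Q x w y → σ.step π u mode y = σ.step π u mode y₀ ∧
          σ.nextTime mode y = σ.nextTime mode y₀ := fun y hy =>
        State.step_congr π u e (fun f _ => hcong y hy y₀ hy₀ f) (Or.inl (hcong y hy y₀ hy₀ e))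
      by_cases hτ : (t : ℝ≥0∞) < σ.nextTime mode y₀
      · right
        refine ⟨w, hp.sum_le.trans (tsub_le_tsub_right htime a), fun y hy => ?_⟩
        refine lt_hitTime_of_lt_nextTime (n := n) ?_ ?_
        · rw [hrun y hy]; exact hp.not_seen
        · rw [hrun y hy, (hstep y hy).2]; exact hτ
      · left
        rw [not_lt] at hτ
        obtain ⟨T, hT⟩ := WithTop.ne_top_iff_exists.1 (ne_top_of_le_ne_top ENNReal.coe_ne_top hτ)
        have hTt : T ≤ t := by rw [← hT] at hτ; exact ENNReal.coe_le_coe.1 hτ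
        have hv₀ := hvalid y₀ hy₀
        have hle : σ.time ≤ T := by
          have := hv₀.le_nextTime
          rw [← hT] at this
          exact ENNReal.coe_le_coe.1 this
        refine ⟨w, σ.advance π u mode y₀ T, fun y hy => ?_, hTt, ?_⟩
        · rw [run_succ, hrun y hy, (hstep y hy).1, State.step_eq_advance hT.symm]
        · refine hp.advance hin he hv₀ π u hT.symm (fun l hl hsl => absurd ⟨l, hl, hsl⟩ hs)
            (fun _ => le_rfl) (fun l hl hsl => absurd ⟨l, hl, hsl⟩ hs) ?_
          exact hp.sum_le.trans (tsub_le_tsub_right hle a)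

end ForcedDelay

/-! ### Resampling of independent coordinates; consequences of NBU. -/

section Resampling

variable {Ω Ξ ι : Type*} [MeasurableSpace Ω] [MeasurableSpace Ξ]

open Classical in
/-- The coordinates in `C` are taken from `v'`, the others from `v`. -/
noncomputable def merge (C : Set ι) (v v' : ι → ℝ≥0) : ι → ℝ≥0 := fun i => if i ∈ C then v' i else v i

theorem merge_of_mem {C : Set ι} {v v' : ι → ℝ≥0} {i : ι} (h : i ∈ C) : merge C v v' i = v' i :=
  if_pos h

theorem merge_of_notMem {C : Set ι} {v v' : ι → ℝ≥0} {i : ι} (h : i ∉ C) : merge C v v' i = v i :=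
  if_neg h

variable {μ : Measure Ω} [IsProbabilityMeasure μ] {Y : ι → Ω → ℝ≥0} {ξ : Ω → Ξ}

-- The two blocks of coordinates generate independent σ-algebras. Filling with 0 keeps both as
-- functions on the full index set.
omit [IsProbabilityMeasure μ] in
theorem indepFun_merge (hY : ∀ i, Measurable (Y i)) (hind : iIndepFun Y μ) (C : Set ι) :
    IndepFun (fun ω => merge C (fun i => Y i ω) 0) (fun ω => merge C 0 fun i => Y i ω) μ := by
  have h1 := indep_iSup_of_disjoint (fun i => (hY i).comap_le) hind.iIndep
    (disjoint_compl_left (a := C))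
  have hle : ∀ (D : Set ι) i, i ∈ D → (MeasurableSpace.comap (Y i) inferInstance)
      ≤ ⨆ i ∈ D, MeasurableSpace.comap (Y i) inferInstance := fun D i hi =>
    le_iSup₂_of_le i hi le_rfl
  rw [IndepFun_iff_Indep]
  refine indep_of_indep_of_le_right (indep_of_indep_of_le_left h1 ?_) ?_
  · rw [← measurable_iff_comap_le]
    refine @measurable_pi_lambda _ _ _ (_) _ _ fun i => ?_
    by_cases hi : i ∈ C
    · simp only [merge_of_mem hi]
      exact @measurable_const _ _ _ (_) _
    · simp only [merge_of_notMem hi]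
      exact measurable_iff_comap_le.2 (hle _ i hi)
  · rw [← measurable_iff_comap_le]
    refine @measurable_pi_lambda _ _ _ (_) _ _ fun i => ?_
    by_cases hi : i ∈ C
    · simp only [merge_of_mem hi]
      exact measurable_iff_comap_le.2 (hle _ i hi)
    · simp only [merge_of_notMem hi]
      exact @measurable_const _ _ _ (_) _

theorem measurable_merge {Z : Type*} [MeasurableSpace Z] (C : Set ι) {f g : Z → ι → ℝ≥0}
    (hf : Measurable f) (hg : Measurable g) : Measurable fun z => merge C (f z) (g z) := by
  refine measurable_pi_lambda _ fun i => ?_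
  by_cases hi : i ∈ C
  · simp only [merge_of_mem hi]
    exact hg.eval
  · simp only [merge_of_notMem hi]
    exact hf.eval

/-- Some coordinates of an independent family may be replaced with independent copies. -/
theorem measure_resample (hY : ∀ i, Measurable (Y i)) (hind : iIndepFun Y μ) (hξ : Measurable ξ)
    (hξY : IndepFun ξ (fun ω i => Y i ω) μ) (C : Set ι) {S : Set (Ξ × (ι → ℝ≥0))}
    (hS : MeasurableSet S) :
    μ {ω | (ξ ω, fun i => Y i ω) ∈ S}
      = ∫⁻ ω, μ {ω' | (ξ ω, merge C (fun i => Y i ω) fun i => Y i ω') ∈ S} ∂μ := by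
  set A : Ω → ι → ℝ≥0 := fun ω => merge C (fun i => Y i ω) 0
  set V : Ω → ι → ℝ≥0 := fun ω => merge C 0 fun i => Y i ω
  have hYm : Measurable fun ω i => Y i ω := measurable_pi_lambda _ hY
  have hA : Measurable A := measurable_merge C hYm measurable_const
  have hV : Measurable V := measurable_merge C measurable_const hYm
  have hAV := (indepFun_iff_map_prod_eq_prod_map_map hA.aemeasurable hV.aemeasurable).1
    (indepFun_merge hY hind C)
  have hmA : Measurable fun v : ι → ℝ≥0 => merge C v 0 :=
    measurable_merge C measurable_id measurable_const
  have hmV : Measurable fun v : ι → ℝ≥0 => merge C 0 v :=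
    measurable_merge C measurable_const measurable_id
  have hξAV := (indepFun_iff_map_prod_eq_prod_map_map hξ.aemeasurable
    (hA.prodMk hV).aemeasurable).1 (hξY.comp measurable_id (hmA.prodMk hmV))
  have hξA := (indepFun_iff_map_prod_eq_prod_map_map hξ.aemeasurable
    hA.aemeasurable).1 (hξY.comp measurable_id hmA)
  -- The seed is independent of (A, V) and A of V; associativity of product measures then makes
  -- (seed, A) independent of V.
  have hlaw : μ.map (fun ω => ((ξ ω, A ω), V ω)) = (μ.map fun ω => (ξ ω, A ω)).prod (μ.map V) := by
    rw [hξA]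
    apply MeasurableEquiv.prodAssoc.map_measurableEquiv_injective
    have := Measure.isProbabilityMeasure_map (μ := μ) hV.aemeasurable
    rw [Measure.prodAssoc_prod, ← hAV, ← hξAV, Measure.map_map (MeasurableEquiv.measurable _)
      ((hξ.prodMk hA).prodMk hV)]
    rfl
  have hmerge : ∀ ω ω', merge C (A ω) (V ω') = merge C (fun i => Y i ω) fun i => Y i ω' := by
    intro ω ω'
    funext i
    by_cases hi : i ∈ C
    · simp only [merge_of_mem hi, V]
    · simp only [merge_of_notMem hi, A]
  have hself : ∀ ω, merge C (A ω) (V ω) = fun i => Y i ω := by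
    intro ω
    rw [hmerge]
    funext i
    by_cases hi : i ∈ C
    · rw [merge_of_mem hi]
    · rw [merge_of_notMem hi]
  have hm : Measurable fun z : (Ξ × (ι → ℝ≥0)) × (ι → ℝ≥0) => (z.1.1, merge C z.1.2 z.2) :=
    measurable_fst.fst.prodMk (measurable_merge C measurable_fst.snd measurable_snd)
  have h1 : μ {ω | (ξ ω, fun i => Y i ω) ∈ S} = μ.map (fun ω => ((ξ ω, A ω), V ω))
      ((fun z : (Ξ × (ι → ℝ≥0)) × (ι → ℝ≥0) => (z.1.1, merge C z.1.2 z.2)) ⁻¹' S) := by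
    rw [Measure.map_apply ((hξ.prodMk hA).prodMk hV) (hm hS)]
    congr 1
    ext ω
    simp only [Set.mem_ofPred_eq, Set.mem_preimage, hself]
  have := Measure.isProbabilityMeasure_map (μ := μ) hV.aemeasurable
  rw [h1, hlaw, Measure.prod_apply (hm hS), lintegral_map (measurable_measure_prodMk_left (hm hS))
    (hξ.prodMk hA)]
  refine lintegral_congr fun ω => ?_
  rw [Measure.map_apply hV (measurable_prodMk_left (hm hS))]
  congr 1
  ext ω'
  simp only [Set.mem_ofPred_eq, Set.mem_preimage, hmerge]

/-- Iterated NBU: spreading an amount of work over several new transmissions does not make it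
likelier that one of them ends. -/
theorem IsNBU.tail_sum_le {Y : Ω → ℝ≥0} (h : IsNBU μ Y) {κ : Type*}
    (s : Finset κ) (w : κ → ℝ≥0) :
    μ {ω | ∑ i ∈ s, w i < Y ω} ≤ ∏ i ∈ s, μ {ω | w i < Y ω} := by
  classical
  induction s using Finset.induction_on with
  | empty => simpa using prob_le_one
  | insert a s ha ih =>
    rw [Finset.sum_insert ha, Finset.prod_insert ha]
    exact (h _ _).trans (by gcongr)

/-- If there is a positive probability of any positive transmission time, then the transmission
time is positive almost surely. -/
theorem IsNBU.tail_zero {Y : Ω → ℝ≥0} (h : IsNBU μ Y) (h0 : μ {ω | 0 < Y ω} ≠ 0) :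
    μ {ω | 0 < Y ω} = 1 := by
  -- With p = P(Y > 0) this reads p ≤ p², which forces p = 1 when p ≠ 0.
  have h1 := h 0 0
  rw [add_zero] at h1
  refine le_antisymm prob_le_one ?_
  by_contra! hc
  have : μ {ω | 0 < Y ω} * μ {ω | 0 < Y ω} < μ {ω | 0 < Y ω} * 1 :=
    ENNReal.mul_lt_mul_right h0 (measure_ne_top _ _) hc
  rw [mul_one] at this
  exact absurd h1 (not_le.2 this)

end Resampling

/-! ### The two stochastic bounds: delivery under any policy, and residual times under LGFS. -/

section RandomTransmission

variable {N : ℕ} {I : Network N} {Ω Ξ : Type*} [MeasurableSpace Ω] [MeasurableSpace Ξ]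
  {μ : Measure Ω} {X : I.Link → ℕ → ℕ → Ω → ℝ≥0} {ξ : Ω → Ξ}

/-- The probabilistic assumptions on the transmission times and the random seed. -/
structure RandomTimes (μ : Measure Ω) (X : I.Link → ℕ → ℕ → Ω → ℝ≥0) (ξ : Ω → Ξ) : Prop where
  measurable : ∀ e l n, Measurable (X e l n)
  indep : iIndepFun (fun (i : I.Link × ℕ × ℕ) => X i.1 i.2.1 i.2.2) μ
  ident : ∀ e l n, IdentDistrib (X e l n) (X e 0 0) μ μ
  nbu : ∀ e, IsNBU μ (X e 0 0)
  measurable_seed : Measurable ξ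
  indep_seed : IndepFun ξ (fun ω (i : I.Link × ℕ × ℕ) => X i.1 i.2.1 i.2.2 ω) μ

/-- A family indexed by triples, as a function of link, packet and attempt. -/
def timesOf (v : I.Link × ℕ × ℕ → ℝ≥0) : I.Link → ℕ → ℕ → ℝ≥0 := fun e l n => v (e, l, n)

theorem measurable_timesOf (e : I.Link) (l n : ℕ) :
    Measurable fun z : Ξ × (I.Link × ℕ × ℕ → ℝ≥0) => timesOf z.2 e l n :=
  measurable_snd.eval

theorem RandomTimes.tail_eq (h : RandomTimes μ X ξ) (e : I.Link) (l n : ℕ) (t : ℝ≥0) :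
    μ {ω | t < X e l n ω} = μ {ω | t < X e 0 0 ω} :=
  (h.ident e l n).measure_mem_eq measurableSet_Ioi

variable [IsProbabilityMeasure μ]

/-- All transmission times of a link exceed their share of an amount of work with at least the
probability that a single one exceeds the total. -/
theorem RandomTimes.tail_le_forall (h : RandomTimes μ X ξ) (e : I.Link) (w : ℕ × ℕ →₀ ℝ≥0)
    {r : ℝ≥0} (hw : (w.sum fun _ v => v) ≤ r) :
    μ {ω | r < X e 0 0 ω} ≤ μ {ω | ∀ l n, w (l, n) < X e l n ω} := by
  -- If X = 0 almost surely, the left side vanishes. Otherwise X > 0 almost surely, which takes care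
  -- of the infinitely many indices outside the support of `w`.
  by_cases h0 : μ {ω | 0 < X e 0 0 ω} = 0
  · refine le_trans (le_of_eq ?_) zero_le
    exact measure_mono_null (fun ω (hω : r < _) => (zero_le.trans_lt hω : (0 : ℝ≥0) < _)) h0
  · have h1 := (h.nbu e).tail_zero h0
    have hpos : ∀ᵐ ω ∂μ, ∀ l n, 0 < X e l n ω := by
      rw [ae_all_iff]
      intro l
      rw [ae_all_iff]
      intro n
      have h2 : μ {ω | 0 < X e l n ω} = 1 := (h.tail_eq e l n 0).trans h1
      exact (prob_compl_eq_zero_iff (measurableSet_lt measurable_const (h.measurable e l n))).2 h2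
    have hinj : Function.Injective fun i : ℕ × ℕ => (e, i.1, i.2) := by
      rintro ⟨a, b⟩ ⟨c, d⟩ hh
      simpa using hh
    have hprod := (h.indep.precomp hinj).measure_inter_preimage_eq_mul w.support
      (sets := fun i => Set.Ioi (w i)) fun i _ => measurableSet_Ioi
    have hle : μ (⋂ i ∈ w.support, X e i.1 i.2 ⁻¹' Set.Ioi (w i))
        ≤ μ {ω | ∀ l n, w (l, n) < X e l n ω} := by
      refine measure_mono_ae ?_
      filter_upwards [hpos] with ω hω hmem l n
      by_cases hi : (l, n) ∈ w.support
      · exact Set.mem_iInter₂.1 hmem (l, n) hi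
      · rw [Finsupp.notMem_support_iff.1 hi]
        exact hω l n
    refine le_trans ?_ (hprod.symm.le.trans hle)
    calc μ {ω | r < X e 0 0 ω} ≤ μ {ω | ∑ i ∈ w.support, w i < X e 0 0 ω} :=
          measure_mono fun ω hω => lt_of_le_of_lt hw hω
      _ ≤ ∏ i ∈ w.support, μ {ω | w i < X e 0 0 ω} := (h.nbu e).tail_sum_le _ _
      _ = ∏ i ∈ w.support, μ (X e i.1 i.2 ⁻¹' Set.Ioi (w i)) :=
          Finset.prod_congr rfl fun i _ => (h.tail_eq e i.1 i.2 (w i)).symm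

variable [NeZero N]

omit [IsProbabilityMeasure μ] in
theorem measurable_hitTime_times (h : RandomTimes μ X ξ) (π : Policy I Ξ) (mode : Preemption)
    {P : State I → Prop} (hP : ∀ {σ : Ω → State I}, MeasState σ → MeasurableSet {z | P (σ z)}) :
    Measurable fun ω => hitTime π (ξ ω) mode (fun e l n => X e l n ω) P :=
  measurable_hitTime π h.measurable_seed mode (P := fun _ => P) h.measurable fun n =>
    hP (measState_run π h.measurable_seed mode h.measurable n)

/-- Whatever the policy, the time from which a packet of `Q` exists until one has passed a given
link is stochastically larger than a transmission time. -/
theorem RandomTimes.tail_le_hitTime (h : RandomTimes μ X ξ) (hin : I.SingleIn) {e : I.Link}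
    (he : I.dst e ≠ 0) (π : Policy I Ξ) (mode : Preemption) {Q : Set ℕ} {a : ℝ≥0}
    (ha : ∀ l ∈ Q, (a : ℝ≥0∞) ≤ I.arr l) (t : ℝ≥0) :
    μ {ω | t - a < X e 0 0 ω} ≤ μ {ω | (t : ℝ≥0∞) <
      hitTime π (ξ ω) mode (fun e l n => X e l n ω) (SeenAt (I.dst e) Q)} := by
  -- A policy may take infinitely many decisions in bounded time, so no single `w` need settle the
  -- matter. The event is weakened to the first `n` epochs; these events decrease to the desired
  -- one, and continuity from above concludes.
  let S : ℕ → Set (Ξ × (I.Link × ℕ × ℕ → ℝ≥0)) := fun n =>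
    {z | (t : ℝ≥0∞) < hitTime π z.1 mode (timesOf z.2) (SeenAt (I.dst e) Q) ∨
      ¬ SeenAt (I.dst e) Q (run π z.1 mode (timesOf z.2) n)}
  have hrun : ∀ n, MeasState fun z : Ξ × (I.Link × ℕ × ℕ → ℝ≥0) =>
      run π z.1 mode (timesOf z.2) n := fun n =>
    measState_run π measurable_fst mode measurable_timesOf n
  have hSm : ∀ n, MeasurableSet (S n) := fun n =>
    (measurableSet_lt measurable_const (measurable_hitTime π measurable_fst mode
      (P := fun _ => SeenAt (I.dst e) Q) measurable_timesOf
        fun n => (hrun n).measurableSet_seenAt _ _)).union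
      ((hrun n).measurableSet_seenAt _ _).compl
  have hZ : Measurable fun ω => (ξ ω, fun i : I.Link × ℕ × ℕ => X i.1 i.2.1 i.2.2 ω) :=
    h.measurable_seed.prodMk (measurable_pi_lambda _ fun i => h.measurable _ _ _)
  let E : ℕ → Set Ω := fun n => {ω | (ξ ω, fun i : I.Link × ℕ × ℕ => X i.1 i.2.1 i.2.2 ω) ∈ S n}
  have hEanti : Antitone E := by
    refine antitone_nat_of_succ_le fun n ω hω => ?_
    rcases hω with hω | hω
    · exact Or.inl hω
    · exact Or.inr fun ⟨l, hl, hlQ⟩ =>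
        hω ⟨l, monotone_seen _ _ _ _ _ n.le_succ hl, hlQ⟩
  have hElow : ∀ n, μ {ω | t - a < X e 0 0 ω} ≤ μ (E n) := by
    intro n
    -- All transmission times of packets of `Q` over `e` are redrawn with the rest fixed; the shares
    -- `w` then depend only on what is fixed.
    let C : Set (I.Link × ℕ × ℕ) := {i | i.1 = e ∧ i.2.1 ∈ Q}
    have hres := measure_resample (fun i : I.Link × ℕ × ℕ => h.measurable i.1 i.2.1 i.2.2) h.indep
      h.measurable_seed h.indep_seed C (hSm n)
    refine le_trans ?_ hres.symm.le
    calc μ {ω | t - a < X e 0 0 ω} = ∫⁻ _, μ {ω | t - a < X e 0 0 ω} ∂μ := by simp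
      _ ≤ _ := lintegral_mono fun ω => ?_
    have hex : ∀ (w : ℕ × ℕ →₀ ℝ≥0) ω', (∀ l n, w (l, n) < X e l n ω') →
        Exceeds e Q (fun e l n => X e l n ω) w (timesOf (merge C
          (fun i : I.Link × ℕ × ℕ => X i.1 i.2.1 i.2.2 ω) fun i => X i.1 i.2.1 i.2.2 ω')) := by
      intro w ω' hω'
      refine ⟨fun f l m hfl => merge_of_notMem hfl, fun l m hl => ?_⟩
      change _ < merge C _ _ (e, l, m)
      rw [merge_of_mem (show (e, l, m) ∈ C from ⟨rfl, hl⟩)]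
      exact hω' l m
    rcases exists_exceeds_forced hin he π (ξ ω) (fun e l n => X e l n ω) ha (t := t) (mode := mode)
      n with ⟨w, σ, h1, h2, h3⟩ | ⟨w, h1, h2⟩
    · refine (h.tail_le_forall e w (h3.sum_le.trans (tsub_le_tsub_right h2 a))).trans
        (measure_mono fun ω' hω' => Or.inr ?_)
      change ¬ SeenAt _ _ (run π (ξ ω) mode _ n)
      rw [h1 _ (hex w ω' hω')]
      exact h3.not_seen
    · exact (h.tail_le_forall e w h1).trans
        (measure_mono fun ω' hω' => Or.inl (h2 _ (hex w ω' hω')))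
  have hinter : ⋂ n, E n ⊆ {ω | (t : ℝ≥0∞) <
      hitTime π (ξ ω) mode (fun e l n => X e l n ω) (SeenAt (I.dst e) Q)} := by
    intro ω hω
    by_contra hc
    obtain ⟨n, hn, -⟩ := hitTime_le_iff.1 (not_lt.1 hc)
    rcases Set.mem_iInter.1 hω n with h1 | h1
    · exact hc h1
    · exact h1 hn
  refine le_trans ?_ (measure_mono hinter)
  rw [hEanti.measure_iInter (fun n => (hZ (hSm n)).nullMeasurableSet)
    ⟨0, measure_ne_top _ _⟩]
  exact le_iInf hElow

/-- The remaining transmission time of the non-preemptive policy, at the first time at which the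
state has some property, is stochastically smaller than a new transmission time. -/
theorem RandomTimes.residual_le (h : RandomTimes μ X ξ) (mode : Preemption) {P : State I → Prop}
    (hP : ∀ {σ : Ξ × (I.Link × ℕ × ℕ → ℝ≥0) → State I}, MeasState σ → MeasurableSet {z | P (σ z)})
    (e : I.Link) (d : ℝ≥0) :
    μ {ω | ∃ n p, P (run (nonPrmpLGFS I Ξ) (ξ ω) mode (fun e l n => X e l n ω) n) ∧
      (∀ i < n, ¬ P (run (nonPrmpLGFS I Ξ) (ξ ω) mode (fun e l n => X e l n ω) i)) ∧
      (run (nonPrmpLGFS I Ξ) (ξ ω) mode (fun e l n => X e l n ω) n).server e = some p ∧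
      (run (nonPrmpLGFS I Ξ) (ξ ω) mode (fun e l n => X e l n ω) n).time + d
        < (run (nonPrmpLGFS I Ξ) (ξ ω) mode (fun e l n => X e l n ω) n).since e + X e p 0 ω}
      ≤ μ {ω | d < X e 0 0 ω} := by
  let ρ : Ξ × (I.Link × ℕ × ℕ → ℝ≥0) → ℕ → State I :=
    fun z n => run (nonPrmpLGFS I Ξ) z.1 mode (timesOf z.2) n
  have hρ : ∀ n, MeasState fun z => ρ z n := fun n =>
    measState_run _ measurable_fst mode measurable_timesOf n
  let G : ℕ × ℕ → Set (Ξ × (I.Link × ℕ × ℕ → ℝ≥0)) := fun i =>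
    {z | P (ρ z i.1) ∧ (∀ m < i.1, ¬ P (ρ z m)) ∧ (ρ z i.1).server e = some i.2}
  let H : ℕ × ℕ → Set (Ξ × (I.Link × ℕ × ℕ → ℝ≥0)) := fun i =>
    {z | (ρ z i.1).time + d < (ρ z i.1).since e + z.2 (e, i.2, 0)}
  have hG : ∀ i, MeasurableSet (G i) := by
    intro i
    have h1 : MeasurableSet {z | ∀ m < i.1, ¬ P (ρ z m)} := by
      have : {z | ∀ m < i.1, ¬ P (ρ z m)} = ⋂ m, ⋂ (_ : m < i.1), {z | P (ρ z m)}ᶜ := by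
        ext; simp
      rw [this]
      exact MeasurableSet.iInter fun m => MeasurableSet.iInter fun _ => (hP (hρ m)).compl
    exact (hP (hρ i.1)).inter (h1.inter (((hρ i.1).server e).eq_const _))
  have hH : ∀ i, MeasurableSet (H i) := fun i =>
    measurableSet_lt ((hρ i.1).time.add measurable_const)
      (((hρ i.1).since e).add measurable_snd.eval)
  let z : Ω → Ξ × (I.Link × ℕ × ℕ → ℝ≥0) := fun ω => (ξ ω, fun i => X i.1 i.2.1 i.2.2 ω)
  have hz : Measurable z :=
    h.measurable_seed.prodMk (measurable_pi_lambda _ fun i => h.measurable _ _ _)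
  -- Only the transmission time in progress is redrawn. Given the rest, the state at epoch `n` is
  -- the same throughout `G`, and the claim becomes NBU at the elapsed time.
  have key : ∀ i, μ (z ⁻¹' (G i ∩ H i)) ≤ μ {ω | d < X e 0 0 ω} * μ (z ⁻¹' G i) := by
    rintro ⟨n, p⟩
    let C : Set (I.Link × ℕ × ℕ) := {(e, p, 0)}
    have hres := fun {S} hS => measure_resample (S := S)
      (fun i : I.Link × ℕ × ℕ => h.measurable i.1 i.2.1 i.2.2) h.indep
      h.measurable_seed h.indep_seed C hS
    have e1 : μ (z ⁻¹' (G (n, p) ∩ H (n, p))) = _ := hres ((hG (n, p)).inter (hH (n, p)))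
    have e2 : μ (z ⁻¹' G (n, p)) = _ := hres (hG (n, p))
    rw [e1, e2, ← lintegral_const_mul' _ _ (measure_ne_top _ _)]
    refine lintegral_mono fun ω => ?_
    let y : Ω → I.Link × ℕ × ℕ → ℝ≥0 := fun ω' =>
      merge C (fun i => X i.1 i.2.1 i.2.2 ω) fun i => X i.1 i.2.1 i.2.2 ω'
    have hyp : ∀ ω', timesOf (y ω') e p 0 = X e p 0 ω' := fun ω' => by
      simp only [y, timesOf]
      rw [merge_of_mem (show (e, p, 0) ∈ C from rfl)]
    have hyne : ∀ ω' ω'' f q, (f, q) ≠ (e, p) → timesOf (y ω') f q 0 = timesOf (y ω'') f q 0 := by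
      intro ω' ω'' f q hfq
      have hnot : (f, q, 0) ∉ C := fun hc => hfq (by
        have : (f, q, 0) = (e, p, 0) := hc
        simp only [Prod.mk.injEq] at this ⊢
        exact ⟨this.1, this.2.1⟩)
      simp only [y, timesOf]
      rw [merge_of_notMem hnot, merge_of_notMem hnot]
    change μ {ω' | (ξ ω, y ω') ∈ G (n, p) ∩ H (n, p)} ≤ μ _ * μ {ω' | (ξ ω, y ω') ∈ G (n, p)}
    by_cases hne : ∃ ω₀, (ξ ω, y ω₀) ∈ G (n, p)
    swap
    · push Not at hne
      have : {ω' | (ξ ω, y ω') ∈ G (n, p) ∩ H (n, p)} = ∅ :=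
        Set.eq_empty_of_forall_notMem fun ω' hω' => hne ω' hω'.1
      rw [this, measure_empty]
      exact zero_le
    obtain ⟨ω₀, hω₀⟩ := hne
    set σ := ρ (ξ ω, y ω₀) n with hσ
    have hsince : σ.since e ≤ σ.time :=
      (valid_run (nonPrmpLGFS I Ξ) (ξ ω) mode (timesOf (y ω₀)) n).since_le e
    have h1 : {ω' | (ξ ω, y ω') ∈ G (n, p) ∩ H (n, p)}
        ⊆ {ω' | (σ.time - σ.since e) + d < X e p 0 ω'} := by
      rintro ω' ⟨hω', hω''⟩
      -- `lgfs_run_congr` transfers the run from the shorter transmission time to the longer one,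
      -- whichever of the two is shorter.
      have heq : ρ (ξ ω, y ω') n = σ := by
        rcases le_total (X e p 0 ω₀) (X e p 0 ω') with hle | hle
        · exact lgfs_run_congr (hyne ω₀ ω') hω₀.2.2 (Or.inl (by rwa [hyp, hyp])) le_rfl
        · exact (lgfs_run_congr (hyne ω' ω₀) hω'.2.2 (Or.inl (by rwa [hyp, hyp])) le_rfl).symm
      have h2 : (ρ (ξ ω, y ω') n).time + d
        < (ρ (ξ ω, y ω') n).since e + timesOf (y ω') e p 0 := hω''
      rw [heq, hyp, ← add_tsub_cancel_of_le hsince, add_assoc] at h2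
      exact lt_of_add_lt_add_left h2
    -- Conversely, any transmission time longer than the elapsed time leaves the run unchanged up to
    -- epoch `n`.
    have h2 : {ω' | σ.time - σ.since e < X e p 0 ω'} ⊆ {ω' | (ξ ω, y ω') ∈ G (n, p)} := by
      intro ω' hω'
      have heq : ∀ m ≤ n, ρ (ξ ω, y ω') m = ρ (ξ ω, y ω₀) m := fun m hm =>
        lgfs_run_congr (hyne ω₀ ω') hω₀.2.2
          (Or.inr (by rw [hyp]; exact (tsub_lt_iff_left hsince).1 hω')) hm
      refine ⟨?_, fun m hm => ?_, ?_⟩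
      · change P (ρ (ξ ω, y ω') n)
        rw [heq n le_rfl]
        exact hω₀.1
      · rw [heq m (le_of_lt hm)]
        exact hω₀.2.1 m hm
      · change (ρ (ξ ω, y ω') n).server e = some p
        rw [heq n le_rfl]
        exact hω₀.2.2
    calc μ {ω' | (ξ ω, y ω') ∈ G (n, p) ∩ H (n, p)}
        ≤ μ {ω' | (σ.time - σ.since e) + d < X e p 0 ω'} := measure_mono h1
      _ = μ {ω' | (σ.time - σ.since e) + d < X e 0 0 ω'} := h.tail_eq e p 0 _
      _ ≤ μ {ω' | σ.time - σ.since e < X e 0 0 ω'} * μ {ω' | d < X e 0 0 ω'} := h.nbu e _ _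
      _ = μ {ω' | d < X e 0 0 ω'} * μ {ω' | σ.time - σ.since e < X e p 0 ω'} := by
          rw [mul_comm, h.tail_eq e p 0]
      _ ≤ _ := by gcongr
  have hdisj : Pairwise (Function.onFun Disjoint fun i => z ⁻¹' G i) := by
    rintro ⟨n, p⟩ ⟨m, q⟩ hne
    refine Set.disjoint_left.2 fun ω h1 h2 => hne ?_
    have hnm : n = m := by
      rcases lt_trichotomy n m with hlt | heq | hlt
      · exact absurd h1.1 (h2.2.1 n hlt)
      · exact heq
      · exact absurd h2.1 (h1.2.1 m hlt)
    subst hnm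
    have := h1.2.2.symm.trans h2.2.2
    rw [Prod.mk.injEq]
    exact ⟨rfl, Option.some.inj this⟩
  calc _ ≤ μ (⋃ i, z ⁻¹' (G i ∩ H i)) := by
        refine measure_mono ?_
        rintro ω ⟨n, p, h1, h2, h3, h4⟩
        exact Set.mem_iUnion.2 ⟨(n, p), ⟨h1, h2, h3⟩, h4⟩
    _ ≤ ∑' i, μ (z ⁻¹' (G i ∩ H i)) := measure_iUnion_le _
    _ ≤ ∑' i, μ {ω | d < X e 0 0 ω} * μ (z ⁻¹' G i) := ENNReal.tsum_le_tsum key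
    _ = μ {ω | d < X e 0 0 ω} * μ (⋃ i, z ⁻¹' G i) := by
        rw [ENNReal.tsum_mul_left, measure_iUnion hdisj fun i => hz (hG i)]
    _ ≤ μ {ω | d < X e 0 0 ω} * 1 := by gcongr; exact prob_le_one
    _ = _ := mul_one _

end RandomTransmission

/-! ### Layer-cake formulas and the exchange of integrals. -/

section Integrals

variable {Ω : Type*} [MeasurableSpace Ω] {μ : Measure Ω}

theorem volume_Ici_inter_lt (c : ℝ≥0) (v : ℝ≥0∞) :
    volume {t : ℝ | (c : ℝ) ≤ t ∧ ENNReal.ofReal t < v} ≤ v - c := by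
  induction v using ENNReal.recTopCoe with
  | top => simp
  | coe b =>
    calc volume {t : ℝ | (c : ℝ) ≤ t ∧ ENNReal.ofReal t < b} ≤ volume (Set.Ico (c : ℝ) b) := by
          refine measure_mono fun t ht => ⟨ht.1, ?_⟩
          have h1 := ht.2
          rw [ENNReal.ofReal, ENNReal.coe_lt_coe, ← NNReal.coe_lt_coe,
            Real.coe_toNNReal t (c.coe_nonneg.trans ht.1)] at h1
          exact h1
      _ = b - c := by
          rw [Real.volume_Ico, ← ENNReal.ofReal_coe_nnreal, ← ENNReal.ofReal_coe_nnreal,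
            ENNReal.ofReal_sub _ c.coe_nonneg]

theorem volume_Ioi_inter_lt (v : ℝ≥0∞) :
    volume {t : ℝ | 0 < t ∧ ENNReal.ofReal t < v} = v := by
  induction v using ENNReal.recTopCoe with
  | top =>
    have : {t : ℝ | 0 < t ∧ ENNReal.ofReal t < ⊤} = Set.Ioi 0 := by ext; simp
    rw [this, Real.volume_Ioi]
  | coe b =>
    have : {t : ℝ | 0 < t ∧ ENNReal.ofReal t < b} = Set.Ioo 0 (b : ℝ) := by
      ext t
      constructor
      · rintro ⟨h0, h1⟩
        rw [ENNReal.ofReal, ENNReal.coe_lt_coe, ← NNReal.coe_lt_coe, Real.coe_toNNReal t h0.le] at h1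
        exact ⟨h0, h1⟩
      · rintro ⟨h0, h1⟩
        refine ⟨h0, ?_⟩
        rwa [ENNReal.ofReal, ENNReal.coe_lt_coe, ← NNReal.coe_lt_coe, Real.coe_toNNReal t h0.le]
    rw [this, Real.volume_Ioo, sub_zero, ENNReal.ofReal_coe_nnreal]

theorem lintegral_eq_lintegral_tail [SFinite μ] {f : Ω → ℝ≥0∞} (hf : Measurable f) :
    ∫⁻ ω, f ω ∂μ = ∫⁻ t in Set.Ioi (0 : ℝ), μ {ω | ENNReal.ofReal t < f ω} := by
  have hm : MeasurableSet {p : Ω × ℝ | 0 < p.2 ∧ ENNReal.ofReal p.2 < f p.1} :=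
    (measurableSet_lt measurable_const measurable_snd).inter
      (measurableSet_lt measurable_snd.ennreal_ofReal (hf.comp measurable_fst))
  have h1 := Measure.prod_apply (μ := μ) (ν := (volume : Measure ℝ)) hm
  have h2 := Measure.prod_apply_symm (μ := μ) (ν := (volume : Measure ℝ)) hm
  rw [h2] at h1
  have h3 : ∀ ω, volume (Prod.mk ω ⁻¹' {p : Ω × ℝ | 0 < p.2 ∧ ENNReal.ofReal p.2 < f p.1}) = f ω :=
    fun ω => volume_Ioi_inter_lt (f ω)
  simp only [h3] at h1
  rw [← h1, ← lintegral_indicator measurableSet_Ioi]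
  refine lintegral_congr fun t => ?_
  by_cases ht : 0 < t
  · rw [Set.indicator_of_mem (show t ∈ Set.Ioi 0 from ht)]
    congr 1
    ext ω
    simp [ht]
  · rw [Set.indicator_of_notMem (show t ∉ Set.Ioi 0 from ht)]
    have : (fun x : Ω => (x, t)) ⁻¹' {p : Ω × ℝ | 0 < p.2 ∧ ENNReal.ofReal p.2 < f p.1} = ∅ := by
      ext ω
      simp [ht]
    rw [this, measure_empty]

theorem lintegral_tsub_le_of_tail_le [SFinite μ] {A S : Ω → ℝ≥0∞} (hA : Measurable A)
    (hS : Measurable S) {Y : Ω → ℝ≥0} (hY : Measurable Y)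
    (h : ∀ d : ℝ≥0, μ {ω | A ω + d < S ω} ≤ μ {ω | d < Y ω}) :
    ∫⁻ ω, (S ω - A ω) ∂μ ≤ ∫⁻ ω, (Y ω : ℝ≥0∞) ∂μ := by
  rw [lintegral_eq_lintegral_tail (f := fun ω => S ω - A ω) (hS.sub hA),
    lintegral_eq_lintegral_tail hY.coe_nnreal_ennreal]
  refine lintegral_mono fun t => ?_
  simp only [lt_tsub_iff_left, ENNReal.ofReal, ENNReal.coe_lt_coe]
  exact h _

/-- Total time in `[s, T]` before the random time `f`, on average. -/
noncomputable def meanTimeBefore (μ : Measure Ω) (s T : ℝ) (f : Ω → ℝ≥0∞) : ℝ≥0∞ :=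
  ∫⁻ t in Set.Icc s T, μ {ω | ENNReal.ofReal t < f ω}

theorem meanTimeBefore_eq [SFinite μ] (s T : ℝ) {f : Ω → ℝ≥0∞} (hf : Measurable f) :
    meanTimeBefore μ s T f
      = ∫⁻ ω, (volume.restrict (Set.Icc s T)) {t | ENNReal.ofReal t < f ω} ∂μ := by
  have hm : MeasurableSet {p : Ω × ℝ | ENNReal.ofReal p.2 < f p.1} :=
    measurableSet_lt measurable_snd.ennreal_ofReal (hf.comp measurable_fst)
  have h1 := Measure.prod_apply (μ := μ) (ν := (volume : Measure ℝ).restrict (Set.Icc s T)) hm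
  have h2 := Measure.prod_apply_symm (μ := μ) (ν := (volume : Measure ℝ).restrict (Set.Icc s T)) hm
  exact h2.symm.trans h1

/-- Pathwise, the points of [s, T] before `g` but not before `f` have length at most `g - f`. Where
`f = ⊤` there are none. -/
theorem meanTimeBefore_le_add [SFinite μ] {s : ℝ} (hs : 0 ≤ s) (T : ℝ) {f g : Ω → ℝ≥0∞}
    (hf : Measurable f) (hg : Measurable g) :
    meanTimeBefore μ s T g ≤ meanTimeBefore μ s T f + ∫⁻ ω, (g ω - f ω) ∂μ := by
  have hm : MeasurableSet {p : Ω × ℝ | ENNReal.ofReal p.2 < f p.1} :=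
    measurableSet_lt measurable_snd.ennreal_ofReal (hf.comp measurable_fst)
  have hmf : Measurable fun ω =>
      (volume.restrict (Set.Icc s T)) {t | ENNReal.ofReal t < f ω} :=
    measurable_measure_prodMk_left hm
  rw [meanTimeBefore_eq s T hf, meanTimeBefore_eq s T hg, ← lintegral_add_left hmf]
  refine lintegral_mono fun ω => ?_
  change (volume.restrict (Set.Icc s T)) {t | ENNReal.ofReal t < g ω}
    ≤ (volume.restrict (Set.Icc s T)) {t | ENNReal.ofReal t < f ω} + (g ω - f ω)
  by_cases hfT : f ω = ⊤
  · refine le_trans (measure_mono fun t _ => ?_) le_self_add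
    change _ < f ω
    rw [hfT]
    exact ENNReal.ofReal_lt_top
  · lift f ω to ℝ≥0 using hfT with c
    have hms : ∀ v : ℝ≥0∞, MeasurableSet {t : ℝ | ENNReal.ofReal t < v} := fun v =>
      measurableSet_lt ENNReal.measurable_ofReal measurable_const
    rw [Measure.restrict_apply (hms _), Measure.restrict_apply (hms _)]
    refine le_trans (measure_mono (t := ({t | ENNReal.ofReal t < c} ∩ Set.Icc s T) ∪
      {t : ℝ | (c : ℝ) ≤ t ∧ ENNReal.ofReal t < g ω}) ?_) ((measure_union_le _ _).trans ?_)
    · rintro t ⟨ht1, ht2⟩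
      by_cases ht : ENNReal.ofReal t < c
      · exact Or.inl ⟨ht, ht2⟩
      · refine Or.inr ⟨?_, ht1⟩
        rw [not_lt, ENNReal.ofReal, ENNReal.coe_le_coe, ← NNReal.coe_le_coe,
          Real.coe_toNNReal t (hs.trans ht2.1)] at ht
        exact ht
    · gcongr
      exact volume_Ici_inter_lt c (g ω)

open Classical in
/-- Indicator of `0 ≤ s ≤ t ≤ T` and `t < f s ω`. -/
noncomputable def ageIndicator (f : ℝ → Ω → ℝ≥0∞) (T : ℝ) (ω : Ω) (t s : ℝ) : ℝ≥0∞ :=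
  if (0 ≤ s ∧ s ≤ t ∧ t ≤ T) ∧ ENNReal.ofReal t < f s ω then 1 else 0

/-- Tonelli in ω, t and s. It trades the age at time t for first arrival times indexed by the
generation threshold s. -/
theorem lintegral_ageIndicator [SFinite μ] {f : ℝ → Ω → ℝ≥0∞}
    (hf : Measurable fun p : ℝ × Ω => f p.1 p.2) (T : ℝ) :
    ∫⁻ ω, (∫⁻ t, ∫⁻ s, ageIndicator f T ω t s) ∂μ
      = ∫⁻ s in Set.Icc 0 T, meanTimeBefore μ s T (f s) := by
  classical
  have hm : Measurable fun p : (Ω × ℝ) × ℝ => ageIndicator f T p.1.1 p.1.2 p.2 := by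
    refine Measurable.ite (MeasurableSet.inter (MeasurableSet.inter
      (measurableSet_le measurable_const measurable_snd) (MeasurableSet.inter
      (measurableSet_le measurable_snd measurable_fst.snd)
      (measurableSet_le measurable_fst.snd measurable_const)))
      (measurableSet_lt measurable_fst.snd.ennreal_ofReal
        (hf.comp (measurable_snd.prodMk measurable_fst.fst)))) measurable_const measurable_const
  have hm1 : Measurable fun p : Ω × ℝ => ∫⁻ s, ageIndicator f T p.1 p.2 s :=
    hm.lintegral_prod_right'
  have hm2 : ∀ t, Measurable fun p : Ω × ℝ => ageIndicator f T p.1 t p.2 := fun t =>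
    hm.comp ((measurable_fst.prodMk measurable_const).prodMk measurable_snd)
  have hm3 : Measurable fun p : ℝ × ℝ => ∫⁻ ω, ageIndicator f T ω p.1 p.2 ∂μ := by
    refine Measurable.lintegral_prod_right' (f := fun q : (ℝ × ℝ) × Ω =>
      ageIndicator f T q.2 q.1.1 q.1.2) ?_
    exact hm.comp ((measurable_snd.prodMk measurable_fst.fst).prodMk measurable_fst.snd)
  rw [lintegral_lintegral_swap hm1.aemeasurable]
  have h1 : ∀ t : ℝ, ∫⁻ ω, (∫⁻ s, ageIndicator f T ω t s) ∂μ
      = ∫⁻ s, ∫⁻ ω, ageIndicator f T ω t s ∂μ := fun t =>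
    lintegral_lintegral_swap (hm2 t).aemeasurable
  simp only [h1]
  rw [lintegral_lintegral_swap hm3.aemeasurable, ← lintegral_indicator measurableSet_Icc]
  refine lintegral_congr fun s => ?_
  have hfs : ∀ t, MeasurableSet {ω | ENNReal.ofReal t < f s ω} := fun t =>
    measurableSet_lt measurable_const (hf.comp (measurable_const.prodMk measurable_id))
  by_cases hs : s ∈ Set.Icc 0 T
  · rw [Set.indicator_of_mem hs, meanTimeBefore, ← lintegral_indicator measurableSet_Icc]
    refine lintegral_congr fun t => ?_
    by_cases ht : t ∈ Set.Icc s T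
    · rw [Set.indicator_of_mem ht, ← lintegral_indicator_one (hfs t)]
      refine lintegral_congr fun ω => ?_
      simp [ageIndicator, Set.indicator, hs.1, ht.1, ht.2]
    · rw [Set.indicator_of_notMem ht]
      refine (lintegral_congr fun ω => ?_).trans lintegral_zero
      refine if_neg fun hc => ht ⟨hc.1.2.1, hc.1.2.2⟩
  · rw [Set.indicator_of_notMem hs]
    refine (lintegral_congr fun t => (lintegral_congr fun ω => ?_).trans lintegral_zero).trans
      lintegral_zero
    exact if_neg fun hc => hs ⟨hc.1.1, hc.1.2.1.trans hc.1.2.2⟩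

end Integrals

/-! ### The age as an integral over generation thresholds. -/

section AgeBounds

variable {N : ℕ} [NeZero N] {I : Network N} {Ξ : Type*} [MeasurableSpace Ξ]

/-- The packets generated at time `s` or later. -/
def Network.since (I : Network N) (s : ℝ) : Set ℕ := {l | s.toNNReal ≤ I.gen l}

omit [NeZero N] in
theorem Network.isUpperSet_since (I : Network N) (s : ℝ) : IsUpperSet (I.since s) :=
  fun _ _ hab ha => le_trans ha (I.gen_mono hab)

variable {Ω : Type*} [MeasurableSpace Ω] {ξ : Ω → Ξ} {mode : Preemption}
  {X : I.Link → ℕ → ℕ → Ω → ℝ≥0}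

/-- The time of the first arrival at node `j` of a packet generated at time `s` or later. -/
noncomputable def arrivalTime (π : Policy I Ξ) (ξ : Ω → Ξ) (mode : Preemption)
    (X : I.Link → ℕ → ℕ → Ω → ℝ≥0) (j : Fin N) (s : ℝ) (ω : Ω) : ℝ≥0∞ :=
  hitTime π (ξ ω) mode (fun e l n => X e l n ω) (SeenAt j (I.since s))

/-- The time at which link `e` first sends a packet generated at time `s` or later. -/
noncomputable def serviceTime (π : Policy I Ξ) (ξ : Ω → Ξ) (mode : Preemption)
    (X : I.Link → ℕ → ℕ → Ω → ℝ≥0) (e : I.Link) (s : ℝ) (ω : Ω) : ℝ≥0∞ :=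
  hitTime π (ξ ω) mode (fun e l n => X e l n ω) (ServedOn e (I.since s))

/-- Tonelli needs measurability jointly in the threshold and ω. It holds because the threshold
enters only through countably many conditions s ≤ `gen l`. -/
theorem measurable_arrivalTime_uncurry (hξ : Measurable ξ) (hX : ∀ e l n, Measurable (X e l n))
    (π : Policy I Ξ) (j : Fin N) :
    Measurable fun p : ℝ × Ω => arrivalTime π ξ mode X j p.1 p.2 := by
  refine measurable_hitTime π (hξ.comp measurable_snd) mode
    (P := fun (p : ℝ × Ω) σ => SeenAt j (I.since p.1) σ)
    (fun e l n => (hX e l n).comp measurable_snd) fun n => ?_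
  have hrun := measState_run π (hξ.comp (measurable_snd (α := ℝ))) mode
    (fun e l n => (hX e l n).comp (measurable_snd (α := ℝ))) n
  have : ∀ l, MeasurableSet ({p : ℝ × Ω | l ∈ (run π (ξ p.2) mode (fun e l n => X e l n p.2) n).seen j}
      ∩ {p : ℝ × Ω | p.1.toNNReal ≤ I.gen l}) := fun l =>
    (((hrun.seen j).comp fun S => l ∈ S).pred).inter
      (measurableSet_le measurable_fst.real_toNNReal measurable_const)
  have hU := MeasurableSet.iUnion this
  convert hU using 1
  ext p
  simp [SeenAt, Network.since]

omit [MeasurableSpace Ω] in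
theorem arrivalTime_le_iff {π : Policy I Ξ} {j : Fin N} {s : ℝ} {ω : Ω} {t : ℝ≥0} :
    arrivalTime π ξ mode X j s ω ≤ t ↔
      ∃ l, Reached π (ξ ω) mode (fun e l n => X e l n ω) j t l ∧ s.toNNReal ≤ I.gen l := by
  rw [arrivalTime, hitTime_le_iff]
  constructor
  · rintro ⟨n, ⟨l, hl, hlQ⟩, hn⟩
    exact ⟨l, ⟨n, hn, hl⟩, hlQ⟩
  · rintro ⟨l, ⟨n, hn, hl⟩, hlQ⟩
    exact ⟨n, ⟨l, hl, hlQ⟩, hn⟩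

theorem gen_le_of_reached {π : Policy I Ξ} {u : Ξ} {x : I.Link → ℕ → ℕ → ℝ≥0} {j : Fin N}
    {t : ℝ≥0} {l : ℕ} (h : Reached π u mode x j t l) : I.gen l ≤ t := by
  obtain ⟨n, hn, hl⟩ := h
  have h1 := (I.gen_le_arr l).trans ((valid_run π u mode x n).arr_le j l hl)
  exact (ENNReal.coe_le_coe.1 h1).trans hn

-- If s exceeds the freshest generation time D at time t, then no packet generated at s or later has
-- arrived by t. So the indicator is 1 on (D, t].
omit [MeasurableSpace Ω] in
theorem age_le_lintegral (π : Policy I Ξ) (j : Fin N) (ω : Ω) {T t : ℝ} (ht : t ∈ Set.Icc 0 T) :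
    (age π (ξ ω) mode (fun e l n => X e l n ω) j t.toNNReal : ℝ≥0∞)
      ≤ ∫⁻ s, ageIndicator (arrivalTime π ξ mode X j) T ω t s := by
  classical
  set D := freshest π (ξ ω) mode (fun e l n => X e l n ω) j t.toNNReal with hD
  have h1 : (age π (ξ ω) mode (fun e l n => X e l n ω) j t.toNNReal : ℝ≥0∞)
      = volume (Set.Ioc (D : ℝ) t) := by
    rw [Real.volume_Ioc, age, ← hD, ENNReal.coe_sub, ENNReal.ofReal_sub _ D.coe_nonneg,
      ENNReal.ofReal_coe_nnreal]
    rfl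
  rw [h1, ← lintegral_indicator_one measurableSet_Ioc]
  refine lintegral_mono fun s => ?_
  by_cases hs : s ∈ Set.Ioc (D : ℝ) t
  · rw [Set.indicator_of_mem hs, ageIndicator, if_pos]
    · rfl
    · refine ⟨⟨D.coe_nonneg.trans hs.1.le, hs.2, ht.2⟩, ?_⟩
      by_contra! hc
      obtain ⟨l, hl, hls⟩ := arrivalTime_le_iff.1 hc
      have h2 : I.gen l ≤ D :=
        le_csSup ⟨t.toNNReal, by rintro _ ⟨l', hl', rfl⟩; exact gen_le_of_reached hl'⟩
          ⟨l, hl, rfl⟩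
      have h3 := hls.trans h2
      rw [Real.toNNReal_le_iff_le_coe] at h3
      exact absurd hs.1 (not_lt.2 h3)
  · rw [Set.indicator_of_notMem hs]
    exact zero_le

-- The indicator lives on [D, t], where D belongs to node `j`: what has reached `j` has also reached
-- `i`, so a threshold below D is already met at `i`.
omit [MeasurableSpace Ω] in
theorem lintegral_le_age (π : Policy I Ξ) {i j : Fin N} (ω : Ω) (T t : ℝ)
    (hij : ∀ n, (run π (ξ ω) mode (fun e l n => X e l n ω) n).seen j
      ⊆ (run π (ξ ω) mode (fun e l n => X e l n ω) n).seen i) :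
    ∫⁻ s, ageIndicator (arrivalTime π ξ mode X i) T ω t s ≤ (Set.Icc 0 T).indicator
      (fun t => (age π (ξ ω) mode (fun e l n => X e l n ω) j t.toNNReal : ℝ≥0∞)) t := by
  classical
  by_cases ht : t ∈ Set.Icc 0 T
  swap
  · rw [Set.indicator_of_notMem ht]
    refine le_of_eq ((lintegral_congr fun s => ?_).trans lintegral_zero)
    exact if_neg fun hc => ht ⟨hc.1.1.trans hc.1.2.1, hc.1.2.2⟩
  rw [Set.indicator_of_mem ht]
  set D := freshest π (ξ ω) mode (fun e l n => X e l n ω) j t.toNNReal with hD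
  have h1 : (age π (ξ ω) mode (fun e l n => X e l n ω) j t.toNNReal : ℝ≥0∞)
      = volume (Set.Icc (D : ℝ) t) := by
    rw [Real.volume_Icc, age, ← hD, ENNReal.coe_sub, ENNReal.ofReal_sub _ D.coe_nonneg,
      ENNReal.ofReal_coe_nnreal]
    rfl
  rw [h1, ← lintegral_indicator_one measurableSet_Icc]
  refine lintegral_mono fun s => ?_
  rw [ageIndicator]
  split_ifs with hs
  · rw [Set.indicator_of_mem]
    · rfl
    · refine ⟨?_, hs.1.2.1⟩
      rw [← Real.le_toNNReal_iff_coe_le hs.1.1]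
      refine csSup_le' ?_
      rintro _ ⟨l, ⟨n, hn, hl⟩, rfl⟩
      by_contra! hc
      exact absurd hs.2 (not_lt.2 (arrivalTime_le_iff.2 ⟨l, ⟨n, hn, hij n hl⟩, hc.le⟩))
  · exact zero_le

end AgeBounds

/-! ### Comparison of non-preemptive LGFS with an arbitrary policy along a path. -/

section Comparison

variable {N : ℕ} [NeZero N] {I : Network N} {Ω Ξ : Type*} [MeasurableSpace Ω] [MeasurableSpace Ξ]
  {μ : Measure Ω} [IsProbabilityMeasure μ] {X : I.Link → ℕ → ℕ → Ω → ℝ≥0} {ξ : Ω → Ξ}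

omit [IsProbabilityMeasure μ] in
theorem RandomTimes.measurable_arrivalTime (h : RandomTimes μ X ξ) (π : Policy I Ξ)
    (mode : Preemption) (j : Fin N) (s : ℝ) : Measurable (arrivalTime π ξ mode X j s) :=
  measurable_hitTime_times h π mode fun hσ => hσ.measurableSet_seenAt _ _

omit [IsProbabilityMeasure μ] in
theorem RandomTimes.measurable_serviceTime (h : RandomTimes μ X ξ) (π : Policy I Ξ)
    (mode : Preemption) (e : I.Link) (s : ℝ) : Measurable (serviceTime π ξ mode X e s) :=
  measurable_hitTime_times h π mode fun hσ => hσ.measurableSet_servedOn _ _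

theorem RandomTimes.tail_wait_le (h : RandomTimes μ X ξ) (mode : Preemption) {e : I.Link}
    (hB : 1 ≤ I.buffer e) (s : ℝ) (d : ℝ≥0) :
    μ {ω | arrivalTime (nonPrmpLGFS I Ξ) ξ mode X (I.src e) s ω + d
        < serviceTime (nonPrmpLGFS I Ξ) ξ mode X e s ω} ≤ μ {ω | d < X e 0 0 ω} :=
  (measure_mono fun _ hω => lgfs_busy_of_lt_served (I.isUpperSet_since s) hB hω).trans
    (h.residual_le mode (P := SeenAt (I.src e) (I.since s))
      (fun hσ => hσ.measurableSet_seenAt _ _) e d)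

/-- The mean waiting time of a fresh packet is at most a mean transmission time. -/
theorem RandomTimes.lintegral_wait_le (h : RandomTimes μ X ξ) (mode : Preemption) {e : I.Link}
    (hB : 1 ≤ I.buffer e) (s : ℝ) :
    ∫⁻ ω, (serviceTime (nonPrmpLGFS I Ξ) ξ mode X e s ω
        - arrivalTime (nonPrmpLGFS I Ξ) ξ mode X (I.src e) s ω) ∂μ
      ≤ ∫⁻ ω, (X e 0 0 ω : ℝ≥0∞) ∂μ :=
  lintegral_tsub_le_of_tail_le (h.measurable_arrivalTime _ _ _ _) (h.measurable_serviceTime _ _ _ _)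
    (h.measurable e 0 0) (h.tail_wait_le mode hB s)

theorem RandomTimes.lintegral_service_le (h : RandomTimes μ X ξ) (mode : Preemption) (e : I.Link)
    (s : ℝ) :
    ∫⁻ ω, (arrivalTime (nonPrmpLGFS I Ξ) ξ mode X (I.dst e) s ω
        - serviceTime (nonPrmpLGFS I Ξ) ξ mode X e s ω) ∂μ
      ≤ ∫⁻ ω, (X e 0 0 ω : ℝ≥0∞) ∂μ :=
  lintegral_tsub_le_of_tail_le (h.measurable_serviceTime _ _ _ _) (h.measurable_arrivalTime _ _ _ _)
    (h.measurable e 0 0) fun d =>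
      (measure_mono fun _ hω => lgfs_busy_of_lt_seen hω).trans
        (h.residual_le mode (P := ServedOn e (I.since s))
          (fun hσ => hσ.measurableSet_servedOn _ _) e d)

/-- Over a link that leaves the gateway, the non-preemptive policy starts to send a fresh packet
stochastically no later than any policy delivers one. -/
theorem RandomTimes.tail_service_le (h : RandomTimes μ X ξ) (hin : I.SingleIn) (mode : Preemption)
    {e : I.Link} (hB : 1 ≤ I.buffer e) (hsrc : I.src e = 0) (hdst : I.dst e ≠ 0)
    (π : Policy I Ξ) (s : ℝ) (t : ℝ≥0) :
    μ {ω | (t : ℝ≥0∞) < serviceTime (nonPrmpLGFS I Ξ) ξ mode X e s ω}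
      ≤ μ {ω | (t : ℝ≥0∞) < arrivalTime π ξ mode X (I.dst e) s ω} := by
  -- With a this first arrival time, both sides are compared with P(X > t − a). If a > t, no policy
  -- can have delivered anything and the right side is 1.
  by_cases hat : (⨅ l ∈ I.since s, I.arr l) ≤ t
  · obtain ⟨a, ha⟩ := WithTop.ne_top_iff_exists.1 (ne_top_of_le_ne_top ENNReal.coe_ne_top hat)
    have hat' : a ≤ t := by rw [← ha] at hat; exact ENNReal.coe_le_coe.1 hat
    calc μ {ω | (t : ℝ≥0∞) < serviceTime (nonPrmpLGFS I Ξ) ξ mode X e s ω}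
        ≤ μ {ω | arrivalTime (nonPrmpLGFS I Ξ) ξ mode X (I.src e) s ω + ((t - a : ℝ≥0) : ℝ≥0∞)
          < serviceTime (nonPrmpLGFS I Ξ) ξ mode X e s ω} := by
          refine measure_mono fun ω hω => ?_
          have hlt : (t : ℝ≥0∞) < serviceTime (nonPrmpLGFS I Ξ) ξ mode X e s ω := hω
          refine lt_of_le_of_lt (b := (t : ℝ≥0∞)) ?_ hlt
          have h1 : arrivalTime (nonPrmpLGFS I Ξ) ξ mode X (I.src e) s ω ≤ (a : ℝ≥0∞) := by
            rw [hsrc]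
            exact lgfs_hitTime_gateway_le.trans ha.symm.le
          calc _ ≤ (a : ℝ≥0∞) + ((t - a : ℝ≥0) : ℝ≥0∞) := by gcongr
            _ = t := by rw [← ENNReal.coe_add, add_tsub_cancel_of_le hat']
      _ ≤ μ {ω | t - a < X e 0 0 ω} := h.tail_wait_le mode hB s _
      _ ≤ _ := h.tail_le_hitTime hin hdst π mode (fun l hl => ha.le.trans (iInf₂_le l hl)) t
  · have : {ω | (t : ℝ≥0∞) < arrivalTime π ξ mode X (I.dst e) s ω} = Set.univ := by
      refine Set.eq_univ_of_forall fun ω => ?_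
      by_contra hc
      obtain ⟨n, ⟨l, hl, hls⟩, hn⟩ := hitTime_le_iff.1 (not_lt.1 hc)
      refine hat ((iInf₂_le l hls).trans (((valid_run _ _ _ _ n).arr_le _ l hl).trans ?_))
      exact ENNReal.coe_le_coe.2 hn
    rw [this]
    exact measure_mono (Set.subset_univ _)

/-- Bound on the mean delay of the non-preemptive policy along a path. -/
theorem RandomTimes.meanTimeBefore_path_le (h : RandomTimes μ X ξ) (hin : I.SingleIn)
    (hB : ∀ e : I.Link, 1 ≤ I.buffer e) (mode : Preemption) {k : ℕ} {j : Fin N} {e : ℕ → I.Link}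
    (hpath : I.IsPath e k j) (π : Policy I Ξ) {s : ℝ} (hs : 0 ≤ s) (T : ℝ) {m : ℕ} (hm : 1 ≤ m)
    (hmk : m ≤ k) :
    meanTimeBefore μ s T (arrivalTime (nonPrmpLGFS I Ξ) ξ mode X (I.dst (e m)) s)
      ≤ meanTimeBefore μ s T (arrivalTime π ξ mode X (I.dst (e 1)) s)
        + ((∫⁻ ω, (X (e 1) 0 0 ω : ℝ≥0∞) ∂μ)
          + 2 * ∑ i ∈ Finset.Icc 2 m, ∫⁻ ω, (X (e i) 0 0 ω : ℝ≥0∞) ∂μ) := by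
  have hA := fun j => h.measurable_arrivalTime (nonPrmpLGFS I Ξ) mode j s
  have hS := fun e => h.measurable_serviceTime (nonPrmpLGFS I Ξ) mode e s
  induction m, hm using Nat.le_induction with
  | base =>
    refine (meanTimeBefore_le_add hs T (hS (e 1)) (hA _)).trans ?_
    rw [Finset.Icc_eq_empty (by norm_num), Finset.sum_empty, mul_zero, add_zero]
    refine add_le_add (lintegral_mono fun t => ?_) (h.lintegral_service_le mode (e 1) s)
    exact h.tail_service_le hin mode (hB _) hpath.first (hpath.ne_gateway 1 le_rfl hmk) π s _
  | succ m hm ih =>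
    refine (meanTimeBefore_le_add hs T (hS (e (m + 1))) (hA _)).trans ?_
    have hw := meanTimeBefore_le_add hs T (hA (I.src (e (m + 1)))) (hS (e (m + 1))) (μ := μ)
    rw [hpath.consec m hm (by omega)] at hw
    have hw2 := h.lintegral_wait_le mode (hB (e (m + 1))) s
    rw [hpath.consec m hm (by omega)] at hw2
    calc _ ≤ (meanTimeBefore μ s T (arrivalTime π ξ mode X (I.dst (e 1)) s)
        + ((∫⁻ ω, (X (e 1) 0 0 ω : ℝ≥0∞) ∂μ)
          + 2 * ∑ i ∈ Finset.Icc 2 m, ∫⁻ ω, (X (e i) 0 0 ω : ℝ≥0∞) ∂μ)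
        + ∫⁻ ω, (X (e (m + 1)) 0 0 ω : ℝ≥0∞) ∂μ) + ∫⁻ ω, (X (e (m + 1)) 0 0 ω : ℝ≥0∞) ∂μ := by
          exact add_le_add (hw.trans (add_le_add (ih (by omega)) hw2))
            (h.lintegral_service_le mode (e (m + 1)) s)
      _ = _ := by
          rw [Finset.sum_Icc_succ_top (by omega)]
          ring

/-- A packet that has reached the end of a path has passed its first link. -/
theorem Network.IsPath.seen_subset (hin : I.SingleIn) {k : ℕ} {j : Fin N} {e : ℕ → I.Link}
    (hpath : I.IsPath e k j) (π : Policy I Ξ) (u : Ξ) (mode : Preemption)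
    (x : I.Link → ℕ → ℕ → ℝ≥0) (n : ℕ) :
    (run π u mode x n).seen j ⊆ (run π u mode x n).seen (I.dst (e 1)) := by
  suffices hm : ∀ m, 1 ≤ m → m ≤ k →
      (run π u mode x n).seen (I.dst (e m)) ⊆ (run π u mode x n).seen (I.dst (e 1)) by
    have := hm k hpath.pos le_rfl
    rwa [hpath.last] at this
  intro m hm
  induction m, hm using Nat.le_induction with
  | base => exact fun _ => subset_rfl
  | succ m hm ih =>
    intro hmk l hl
    have h1 := seen_src_of_seen_dst hin (hpath.ne_gateway (m + 1) (by omega) hmk) hl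
    rw [hpath.consec m hm (by omega)] at h1
    exact ih (by omega) h1

/-- Each threshold s in [0, T] costs at most the constant, so the total cost is the constant times
T. For `π` only the delay up to the first node of the path is used, which is a lower bound for its
delay at `j`. -/
theorem RandomTimes.lintegral_age_le (h : RandomTimes μ X ξ) (hin : I.SingleIn)
    (hB : ∀ e : I.Link, 1 ≤ I.buffer e) (mode : Preemption) {k : ℕ} {j : Fin N} {e : ℕ → I.Link}
    (hpath : I.IsPath e k j) (π : Policy I Ξ) (T : ℝ) :
    ∫⁻ ω, (∫⁻ t in Set.Icc (0 : ℝ) T, (age (nonPrmpLGFS I Ξ) (ξ ω) mode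
        (fun e l n => X e l n ω) j t.toNNReal : ℝ≥0∞)) ∂μ
      ≤ (∫⁻ ω, (∫⁻ t in Set.Icc (0 : ℝ) T,
          (age π (ξ ω) mode (fun e l n => X e l n ω) j t.toNNReal : ℝ≥0∞)) ∂μ)
        + ((∫⁻ ω, (X (e 1) 0 0 ω : ℝ≥0∞) ∂μ)
          + 2 * ∑ i ∈ Finset.Icc 2 k, ∫⁻ ω, (X (e i) 0 0 ω : ℝ≥0∞) ∂μ) * ENNReal.ofReal T := by
  set c := (∫⁻ ω, (X (e 1) 0 0 ω : ℝ≥0∞) ∂μ)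
          + 2 * ∑ i ∈ Finset.Icc 2 k, ∫⁻ ω, (X (e i) 0 0 ω : ℝ≥0∞) ∂μ with hc
  have hmeas := fun (π : Policy I Ξ) j =>
    measurable_arrivalTime_uncurry (mode := mode) h.measurable_seed h.measurable π j
  calc _ ≤ ∫⁻ ω, (∫⁻ t, ∫⁻ s,
        ageIndicator (arrivalTime (nonPrmpLGFS I Ξ) ξ mode X j) T ω t s) ∂μ := by
        refine lintegral_mono fun ω => ?_
        exact (setLIntegral_mono' measurableSet_Icc fun t ht =>
          age_le_lintegral _ j ω ht).trans (setLIntegral_le_lintegral _ _)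
    _ = ∫⁻ s in Set.Icc 0 T,
        meanTimeBefore μ s T (arrivalTime (nonPrmpLGFS I Ξ) ξ mode X j s) :=
        lintegral_ageIndicator (hmeas _ j) T
    _ ≤ ∫⁻ s in Set.Icc 0 T,
        (meanTimeBefore μ s T (arrivalTime π ξ mode X (I.dst (e 1)) s) + c) := by
        refine setLIntegral_mono' measurableSet_Icc fun s hs => ?_
        have := h.meanTimeBefore_path_le hin hB mode hpath π hs.1 T hpath.pos le_rfl
        rwa [hpath.last] at this
    _ = (∫⁻ s in Set.Icc 0 T,
        meanTimeBefore μ s T (arrivalTime π ξ mode X (I.dst (e 1)) s)) + c * ENNReal.ofReal T := by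
        rw [lintegral_add_right _ measurable_const, setLIntegral_const, Real.volume_Icc, sub_zero]
    _ = (∫⁻ ω, (∫⁻ t, ∫⁻ s,
        ageIndicator (arrivalTime π ξ mode X (I.dst (e 1))) T ω t s) ∂μ)
          + c * ENNReal.ofReal T := by
        rw [lintegral_ageIndicator (hmeas π (I.dst (e 1))) T]
    _ ≤ _ := by
        refine add_le_add_left (lintegral_mono fun ω => ?_) _
        rw [← lintegral_indicator measurableSet_Icc]
        exact lintegral_mono fun t =>
          lintegral_le_age π ω T t fun n => hpath.seen_subset hin π _ _ _ n

theorem RandomTimes.avgAge_le (h : RandomTimes μ X ξ) (hin : I.SingleIn)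
    (hB : ∀ e : I.Link, 1 ≤ I.buffer e) (mode : Preemption) {k : ℕ} {j : Fin N} {e : ℕ → I.Link}
    (hpath : I.IsPath e k j) (π : Policy I Ξ) :
    avgAge μ ξ mode X (nonPrmpLGFS I Ξ) j ≤ avgAge μ ξ mode X π j
      + ((∫⁻ ω, (X (e 1) 0 0 ω : ℝ≥0∞) ∂μ)
          + 2 * ∑ i ∈ Finset.Icc 2 k, ∫⁻ ω, (X (e i) 0 0 ω : ℝ≥0∞) ∂μ) := by
  set c := (∫⁻ ω, (X (e 1) 0 0 ω : ℝ≥0∞) ∂μ)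
          + 2 * ∑ i ∈ Finset.Icc 2 k, ∫⁻ ω, (X (e i) 0 0 ω : ℝ≥0∞) ∂μ with hc
  let F : ℝ → ℝ≥0∞ := fun T => (∫⁻ ω, (∫⁻ t in Set.Icc (0 : ℝ) T,
      (age π (ξ ω) mode (fun e l n => X e l n ω) j t.toNNReal : ℝ≥0∞)) ∂μ) / ENNReal.ofReal T
  calc avgAge μ ξ mode X (nonPrmpLGFS I Ξ) j ≤ limsup (fun T => F T + c) atTop := by
        refine limsup_le_limsup ?_
        filter_upwards [eventually_gt_atTop 0] with T hT
        have h1 : ENNReal.ofReal T ≠ 0 := by simpa using hT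
        calc _ ≤ _ := ENNReal.div_le_div_right (h.lintegral_age_le hin hB mode hpath π T) _
          _ = F T + c := by
            rw [ENNReal.add_div, ENNReal.mul_div_cancel_right h1 ENNReal.ofReal_ne_top]
    _ = limsup F atTop + c :=
        limsup_add_const atTop F c (by isBoundedDefault) (by isBoundedDefault)

end Comparison

end AgeNet

theorem theorem2 {N : ℕ} [NeZero N] (I : AgeNet.Network N)
    (hin : I.SingleIn) (hB : ∀ e : I.Link, 1 ≤ I.buffer e)
    (mode : AgeNet.Preemption)
    {Ω Ξ : Type*} [MeasurableSpace Ω] [MeasurableSpace Ξ] (μ : Measure Ω) [IsProbabilityMeasure μ]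
    (X : I.Link → ℕ → ℕ → Ω → ℝ≥0) (hX : ∀ e l n, Measurable (X e l n))
    (hindep : iIndepFun (fun (i : I.Link × ℕ × ℕ) => X i.1 i.2.1 i.2.2) μ)
    (hident : ∀ e l n, IdentDistrib (X e l n) (X e 0 0) μ μ)
    (hNBU : ∀ e, AgeNet.IsNBU μ (X e 0 0))
    (ξ : Ω → Ξ) (hξ : Measurable ξ)
    (hξX : IndepFun ξ (fun ω (i : I.Link × ℕ × ℕ) => X i.1 i.2.1 i.2.2 ω) μ)
    (k : ℕ) (j : Fin N) (e : ℕ → I.Link) (hpath : I.IsPath e k j) :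
    (⨅ π : AgeNet.Policy I Ξ, AgeNet.avgAge μ ξ mode X π j)
        ≤ AgeNet.avgAge μ ξ mode X (AgeNet.nonPrmpLGFS I Ξ) j ∧
      AgeNet.avgAge μ ξ mode X (AgeNet.nonPrmpLGFS I Ξ) j
        ≤ (⨅ π : AgeNet.Policy I Ξ, AgeNet.avgAge μ ξ mode X π j)
          + (∫⁻ ω, (X (e 1) 0 0 ω : ℝ≥0∞) ∂μ)
          + 2 * ∑ m ∈ Finset.Icc 2 k, ∫⁻ ω, (X (e m) 0 0 ω : ℝ≥0∞) ∂μ := by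
  refine ⟨iInf_le _ _, ?_⟩
  have h : AgeNet.RandomTimes μ X ξ := ⟨hX, hindep, hident, hNBU, hξ, hξX⟩
  rw [add_assoc, ENNReal.iInf_add]
  exact le_iInf fun π => h.avgAge_le hin hB mode hpath π
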